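/- Notation. Let $\tau\in\mathbb{C}$ with $\operatorname{Im}\tau>0$, $q=e^{2\pi i\tau}$, and let $B_n$ be the Bernoulli numbers ($x/(e^x-1)=\sum_n B_n x^n/n!$). For $\zeta=e^{2\pi i z}$ put, with $\log\zeta=2\pi i z$, $\log q=2\pi i\tau$ and $\mathrm{Li}_3(w)=\sum_{n\ge1}w^n/n^3$, $$\mathcal{L}i_3(\zeta,q)=\sum_{n\ge 0}\mathrm{Li}_3(q^n\zeta)+\sum_{n\ge1}\mathrm{Li}_3(q^n\zeta^{-1})-\sum_{j=0}^{3}\frac{B_{j+1}}{(3-j)!\,(j+1)!}(\log\zeta)^{3-j}(\log q)^j ,$$ $$f(z,\tau)=\frac{1}{(2\pi i)^3}\bigl\{\mathcal{L}i_3(e^{2\pi i z},q)-\mathcal{L}i_3(1,q)\bigr\}\qquad(0<\operatorname{Im}z<\operatorname{Im}\tau).$$ For $n+m=3$ let $f^{(n,m)}(z,\tau)$ denote the single-valued analytic continuation of $\partial^{n+m}f/\partial z^n\partial\tau^m$ in $z$ to $\mathbb{C}\setminus(\mathbb{Z}+\mathbb{Z}\tau)$; it is unique. Let $V$ be a finite-dimensional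 complex vector space with a symmetric bilinear form $(\cdot,\cdot)$, let $\alpha,\beta\in V$ be simple roots of the root system $A_2$, i.e. $(\alpha,\alpha)=(\beta,\beta)=2$, $(\alpha,\beta)=-1$, and let $\mathfrak{U}=\{\alpha,\beta,-(\alpha+\beta)\}$. Write $s_a(z)=z-\frac{2(a,z)}{(a,a)}a$ and $(\hat{s}_a\varphi)(z)=\varphi(s_a z)$. Let $a\mapsto k_a\in\mathbb{C}$ be a multiplicity function on the roots invariant under the Weyl group ($k_{s_a b}=k_b$). For $\xi\in V$ define $$\Xi^{(-1)}(\xi)=\partial_\xi+\sum_{a\in\mathfrak{U}}k_a\,(a,\xi)\,\hat{s}_a,\qquad \Xi^{(i)}(\xi)=\partial_\xi+\sum_{a\in\mathfrak{U}}k_a\,(a,\xi)\,f^{(3-i,i)}((z,a),\tau)\,\hat{s}_a\quad(i=0,1,2,3),$$ and $$\mathbb{F}^{(a,b)}(\xi,\eta)=[\Xi^{(a)}(\xi),\Xi^{(b)}(\eta)]+[\Xi^{(b)}(\xi),\Xi^{(a)}(\eta)].$$ Proposition. The continuations $f^{(3,0)}$ and $f^{(2,1)}$ exist. Let $U\subseteq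 V$ be any open set, stable under $s_a$ for $a\in\mathfrak{U}$, on which $(z,a)\notin\mathbb{Z}+\mathbb{Z}\tau$ for all $a\in\mathfrak{U}$. Then, as operators on holomorphic functions on $U$, for all $\xi,\eta\in V$, $$\mathbb{F}^{(0,-1)}(\xi,\eta)=0,\qquad \mathbb{F}^{(0,0)}(\xi,\eta)+\mathbb{F}^{(1,-1)}(\xi,\eta)=0 .$$ -/

import Mathlib

open Complex

noncomputable section

/-! ### The elliptic trilogarithm -/

/-- The polylogarithm series `Li_r(w) = ∑_{n ≥ 1} w^n / n^r` (used for `|w| < 1`, and at `w = 1`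
for `r = 3`, where it converges). -/
def polylogSeries (r : ℕ) (w : ℂ) : ℂ :=
  ∑' n : ℕ, w ^ (n + 1) / ((n + 1 : ℕ) : ℂ) ^ r

/-- The regularising polynomial `χ_r(ζ, q)` for `ζ = e^{2πiz}`, `q = e^{2πiτ}`, with
`log ζ = 2πiz` and `log q = 2πiτ`. -/
def chiPoly (r : ℕ) (z τ : ℂ) : ℂ :=
  ∑ j ∈ Finset.range (r + 1),
    ((bernoulli (j + 1) : ℚ) : ℂ) / ((Nat.factorial (r - j) : ℂ) * (Nat.factorial (j + 1) : ℂ)) *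
      (2 * Real.pi * I * z) ^ (r - j) * (2 * Real.pi * I * τ) ^ j

/-- The elliptic polylogarithm (`r` odd)
`∑_{n ≥ 0} Li_r(q^n ζ) + ∑_{n ≥ 1} Li_r(q^n ζ⁻¹) - χ_r(ζ, q)`, with `ζ = e^{2πiz}` and
`q = e^{2πiτ}`. All the arguments of `Li_r` have modulus `< 1` when `0 < Im z < Im τ`. -/
def ellPolylog (r : ℕ) (z τ : ℂ) : ℂ :=
  (∑' n : ℕ, polylogSeries r (exp (2 * Real.pi * I * (n * τ + z)))) +
    (∑' n : ℕ, polylogSeries r (exp (2 * Real.pi * I * ((n + 1 : ℕ) * τ - z)))) -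
    chiPoly r z τ

/-- The function `f(z, τ) = (2πi)⁻³ (ℒi₃(e^{2πiz}, q) - ℒi₃(1, q))`, given by convergent series
in the strip `0 < Im z < Im τ`. -/
def ellTrilog (z τ : ℂ) : ℂ :=
  1 / (2 * Real.pi * I) ^ 3 * (ellPolylog 3 z τ - ellPolylog 3 0 τ)

/-- The partial derivative `∂^{n+m} f / ∂z^n ∂τ^m` of the series defining `f`, meant for
`0 < Im z < Im τ`. -/
def ellTrilogPartial (n m : ℕ) (τ z : ℂ) : ℂ :=
  iteratedDeriv m (fun t => iteratedDeriv n (fun w => ellTrilog w t) z) τ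

/-- The lattice `ℤ + ℤτ`. -/
def periodLattice (τ : ℂ) : Set ℂ := {z | ∃ m n : ℤ, z = m + n * τ}

/-- `G` is the analytic continuation of `f^{(n,m)}(·, τ)` from the strip `0 < Im z < Im τ` to
`ℂ ∖ (ℤ + ℤτ)`. (The function `f` is multivalued there, its branches differing by polynomials of
degree at most two in `z` and `τ`, so that its third order derivatives are single valued.) -/
def IsTrilogDeriv (n m : ℕ) (τ : ℂ) (G : ℂ → ℂ) : Prop :=
  DifferentiableOn ℂ G (periodLattice τ)ᶜ ∧
    ∀ z : ℂ, 0 < z.im → z.im < τ.im → G z = ellTrilogPartial n m τ z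

open Classical in
/-- The function `z ↦ f^{(n,m)}(z, τ)` on `ℂ ∖ (ℤ + ℤτ)`: the analytic continuation of the
derivative of the series (which is unique by `IsTrilogDeriv.eqOn`), and zero if there is none. -/
def trilogDeriv (n m : ℕ) (τ : ℂ) : ℂ → ℂ :=
  if h : ∃ G : ℂ → ℂ, IsTrilogDeriv n m τ G then Classical.choose h else 0

theorem countable_periodLattice (τ : ℂ) : (periodLattice τ).Countable := by
  have : periodLattice τ = Set.range (fun p : ℤ × ℤ => (p.1 : ℂ) + p.2 * τ) := by
    ext z
    constructor
    · rintro ⟨m, n, rfl⟩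
      exact ⟨(m, n), rfl⟩
    · rintro ⟨⟨m, n⟩, rfl⟩
      exact ⟨m, n, rfl⟩
  rw [this]
  exact Set.countable_range _

theorem isOpen_compl_periodLattice {τ : ℂ} (hτ : 0 < τ.im) : IsOpen (periodLattice τ)ᶜ := by
  rw [isOpen_compl_iff]
  have hl : LinearIndependent ℝ ![(1 : ℂ), τ] := by
    rw [LinearIndependent.pair_iff]
    intro s t h
    have h2 := congrArg Complex.im h
    have h1 := congrArg Complex.re h
    simp at h1 h2
    have ht : t = 0 := by
      rcases h2 with h2 | h2
      · exact h2
      · exact absurd h2 hτ.ne'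
    subst ht
    simpa using h1
  let b : Module.Basis (Fin 2) ℝ ℂ :=
    basisOfLinearIndependentOfCardEqFinrank hl (by simp [Complex.finrank_real_complex])
  have hb : (Submodule.span ℤ (Set.range b) : Set ℂ) = periodLattice τ := by
    ext z
    have hr : Set.range b = {1, τ} := by
      simp [b, coe_basisOfLinearIndependentOfCardEqFinrank, Matrix.range_cons, Set.pair_comm]
    rw [hr, SetLike.mem_coe, Submodule.mem_span_pair]
    constructor
    · rintro ⟨m, n, rfl⟩
      exact ⟨m, n, by simp⟩
    · rintro ⟨m, n, rfl⟩
      exact ⟨m, n, by simp⟩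
  rw [← hb]
  have : DiscreteTopology (Submodule.span ℤ (Set.range b)).toAddSubgroup := by
    exact inferInstanceAs (DiscreteTopology (Submodule.span ℤ (Set.range b)))
  exact AddSubgroup.isClosed_of_discrete (H := (Submodule.span ℤ (Set.range b)).toAddSubgroup)

/-- The analytic continuation is unique on `ℂ ∖ (ℤ + ℤτ)`. -/
theorem IsTrilogDeriv.eqOn {n m : ℕ} {τ : ℂ} (hτ : 0 < τ.im) {G H : ℂ → ℂ}
    (hG : IsTrilogDeriv n m τ G) (hH : IsTrilogDeriv n m τ H) :
    Set.EqOn G H (periodLattice τ)ᶜ := by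
  have ho := isOpen_compl_periodLattice hτ
  have hc : IsPreconnected (periodLattice τ)ᶜ :=
    ((countable_periodLattice τ).isPathConnected_compl_of_one_lt_rank
      (by rw [Complex.rank_real_complex]; norm_num)).isConnected.isPreconnected
  have hS : IsOpen {z : ℂ | 0 < z.im ∧ z.im < τ.im} :=
    (isOpen_lt continuous_const Complex.continuous_im).inter
      (isOpen_lt Complex.continuous_im continuous_const)
  have h0 : τ / 2 ∈ {z : ℂ | 0 < z.im ∧ z.im < τ.im} := by
    have : (τ / 2).im = τ.im / 2 := by
      simp
    constructor <;> simp only [this] <;> linarith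
  have h0' : τ / 2 ∈ (periodLattice τ)ᶜ := by
    rintro ⟨a, b, h⟩
    have h1 := congrArg Complex.im h
    simp at h1
    have h2 : ((2 * b : ℤ) : ℝ) = 1 := by
      push_cast
      have := hτ.ne'
      field_simp at h1
      linarith
    have h3 : 2 * b = 1 := by exact_mod_cast h2
    omega
  refine (hG.1.analyticOnNhd ho).eqOn_of_preconnected_of_eventuallyEq
    (hH.1.analyticOnNhd ho) hc h0' ?_
  filter_upwards [hS.mem_nhds h0] with z hz
  rw [hG.2 z hz.1 hz.2, hH.2 z hz.1 hz.2]

/-! ### Dunkl-type operators for the root system `A₂` -/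

section Dunkl

variable {V : Type*} [NormedAddCommGroup V] [NormedSpace ℂ V]

/-- The reflection `s_a(z) = z - 2 (a,z)/(a,a) a` for the bilinear form `B`. -/
def rootReflection (B : LinearMap.BilinForm ℂ V) (a z : V) : V :=
  z - (2 * B a z / B a a) • a

/-- The configuration `𝔘 = {α, β, -(α + β)}`. -/
def a2Vectors (α β : V) : Fin 3 → V := ![α, β, -(α + β)]

/-- The points `z` with `(z, a) ∉ ℤ + ℤτ` for all `a ∈ 𝔘`. -/
def a2Regular (B : LinearMap.BilinForm ℂ V) (α β : V) (τ : ℂ) : Set V :=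
  {z | ∀ i, B z (a2Vectors α β i) ∉ periodLattice τ}

/-- The coefficient functions: the constant `1` for the index `-1`, and `f^{(3-i,i)}(·, τ)` for
the indices `i = 0, 1, 2, 3`. -/
def dunklCoeff (τ : ℂ) (i : ℤ) : ℂ → ℂ :=
  if i = -1 then fun _ => 1 else trilogDeriv (3 - i).toNat i.toNat τ

/-- The operator `Ξ^{(i)}(ξ) = ∂_ξ + ∑_{a ∈ 𝔘} k_a (a,ξ) g_i((z,a)) ŝ_a`, where
`(ŝ_a φ)(z) = φ(s_a z)` and `g_i` is the coefficient function of index `i`. -/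
def dunklXi (B : LinearMap.BilinForm ℂ V) (α β : V) (k : V → ℂ) (τ : ℂ) (i : ℤ) (ξ : V)
    (φ : V → ℂ) : V → ℂ := fun z =>
  fderiv ℂ φ z ξ + ∑ j : Fin 3, k (a2Vectors α β j) * B (a2Vectors α β j) ξ *
    dunklCoeff τ i (B z (a2Vectors α β j)) * φ (rootReflection B (a2Vectors α β j) z)

/-- The commutator `[P, Q] = PQ - QP` of operators on functions. -/
def opCommutator (P Q : (V → ℂ) → (V → ℂ)) : (V → ℂ) → (V → ℂ) :=
  fun φ => P (Q φ) - Q (P φ)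

/-- `𝔽^{(a,b)}(ξ,η) = [Ξ^{(a)}(ξ), Ξ^{(b)}(η)] + [Ξ^{(b)}(ξ), Ξ^{(a)}(η)]`. -/
def dunklF (B : LinearMap.BilinForm ℂ V) (α β : V) (k : V → ℂ) (τ : ℂ) (a b : ℤ) (ξ η : V) :
    (V → ℂ) → (V → ℂ) := fun φ =>
  opCommutator (dunklXi B α β k τ a ξ) (dunklXi B α β k τ b η) φ +
    opCommutator (dunklXi B α β k τ b ξ) (dunklXi B α β k τ a η) φ

end Dunkl

end

/-! Write `g` for `f^{(3,0)}` and `h` for `f^{(2,1)}`. Since `𝔽^{(a,b)}(ξ,η)` is the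
antisymmetrisation in `ξ, η` of `Ξ^{(a)}(ξ)Ξ^{(b)}(η) + Ξ^{(b)}(ξ)Ξ^{(a)}(η)`, all terms containing
derivatives of `φ` or of the coefficients cancel (`dunklF_apply`). What remains runs over products
of two distinct reflections of `A₂`, that is, over the two rotations. With `x = (z,α)` and `y =
(z,β)`, oddness of `g` kills the coefficients in `𝔽^{(0,-1)}`, while oddness of `g` and evenness of
`h` reduce the second identity to `g(x)g(y) - (g(x) + g(y))g(x+y) = h(x) + h(y) + h(x+y)`.

This addition formula (`kroneckerOne_addition`) is proved by Eisenstein's method. Termwise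
differentiation of the trilogarithm series turns `Li₃` into `Li₀(ζ) = ζ/(1-ζ)` and presents `g` and
`h` as the series `kroneckerOne` and `kroneckerTwo`. Their terms decay like `|q|^{|n|}`, so they
converge off the whole lattice and are the required continuations. The `n`-th term of `g` plus half
the sign of `n` is a multiple of a cotangent. The addition formula of the cotangent holds for each
pair of indices, the half signs satisfy the same identity, and summing the difference of the two
over `ℤ × ℤ` gives the formula (`tsum_mul_tsum_of_addition`). -/

/-! ### Holomorphic functions of several variables: regularity and symmetry of derivatives -/

/-- Cauchy's estimate on the complex line through `x` in each direction `v`. It is used to make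
holomorphic functions locally Lipschitz. -/
theorem norm_fderiv_le_of_norm_le {V : Type*} [NormedAddCommGroup V] [NormedSpace ℂ V]
    {φ : V → ℂ} {x : V} {R M : ℝ} (hR : 0 < R) (hd : DifferentiableOn ℂ φ (Metric.ball x R))
    (hM : ∀ y ∈ Metric.ball x R, ‖φ y‖ ≤ M) : ‖fderiv ℂ φ x‖ ≤ 2 * M / R := by
  have hM0 : 0 ≤ M := (norm_nonneg _).trans (hM x (Metric.mem_ball_self hR))
  refine ContinuousLinearMap.opNorm_le_bound _ (by positivity) fun v => ?_
  rcases eq_or_ne v 0 with rfl | hv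
  · simp
  have hv' : 0 < ‖v‖ := norm_pos_iff.mpr hv
  -- Half of the admissible radius, so that the closed disc stays in the open ball; this costs the
  -- factor 2.
  set r : ℝ := R / (2 * ‖v‖) with hr
  have hr0 : 0 < r := by positivity
  have hmem : ∀ t ∈ Metric.closedBall (0 : ℂ) r, x + t • v ∈ Metric.ball x R := by
    intro t ht
    rw [mem_closedBall_zero_iff] at ht
    rw [mem_ball_iff_norm, add_sub_cancel_left, norm_smul]
    calc ‖t‖ * ‖v‖ ≤ r * ‖v‖ := by gcongr
      _ = R / 2 := by rw [hr]; field_simp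
      _ < R := by linarith
  have hdt : ∀ t ∈ Metric.closedBall (0 : ℂ) r,
      HasDerivAt (fun t : ℂ => φ (x + t • v)) (fderiv ℂ φ (x + t • v) v) t := by
    intro t ht
    have h1 : HasDerivAt (fun t : ℂ => x + t • v) v t := by
      simpa using ((hasDerivAt_id t).smul_const v).const_add x
    exact ((hd.differentiableAt (Metric.isOpen_ball.mem_nhds (hmem t ht))).hasFDerivAt).comp_hasDerivAt
      t h1
  have hdc : DiffContOnCl ℂ (fun t : ℂ => φ (x + t • v)) (Metric.ball 0 r) := by
    apply DifferentiableOn.diffContOnCl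
    rw [closure_ball _ hr0.ne']
    exact fun t ht => (hdt t ht).differentiableAt.differentiableWithinAt
  have := norm_deriv_le_of_forall_mem_sphere_norm_le hr0 hdc
    (fun t ht => hM _ (hmem t (Metric.sphere_subset_closedBall ht)))
  rw [(hdt 0 (Metric.mem_closedBall_self hr0.le)).deriv, zero_smul, add_zero] at this
  refine this.trans_eq ?_
  rw [hr]
  field_simp

theorem fderiv_apply_eq_circleIntegral {V : Type*} [NormedAddCommGroup V] [NormedSpace ℂ V]
    {φ : V → ℂ} {x η : V} {r : ℝ} (hr : 0 < r) {U : Set V} (hU : IsOpen U)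
    (hd : DifferentiableOn ℂ φ U) (hx : ∀ t ∈ Metric.closedBall (0 : ℂ) r, x + t • η ∈ U) :
    fderiv ℂ φ x η = (2 * Real.pi * I : ℂ)⁻¹ • ∮ t in C(0, r), (t ^ 2)⁻¹ • φ (x + t • η) := by
  have hc : Continuous fun t : ℂ => x + t • η := by fun_prop
  have h1 : ∀ t : ℂ, HasDerivAt (fun t : ℂ => x + t • η) η t := fun t => by
    simpa using ((hasDerivAt_id t).smul_const η).const_add x
  have hdt : ∀ t ∈ (fun t : ℂ => x + t • η) ⁻¹' U,
      HasDerivAt (fun t : ℂ => φ (x + t • η)) (fderiv ℂ φ (x + t • η) η) t := fun t ht =>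
    ((hd.differentiableAt (hU.mem_nhds ht)).hasFDerivAt).comp_hasDerivAt t (h1 t)
  have := Complex.two_pi_I_inv_smul_circleIntegral_sub_sq_inv_smul_of_differentiable
    (hU.preimage hc) hx (fun t ht => (hdt t ht).differentiableAt.differentiableWithinAt)
    (Metric.mem_ball_self hr)
  simp only [sub_zero] at this
  rw [this, (hdt 0 (hx 0 (Metric.mem_closedBall_self hr.le))).deriv, zero_smul, add_zero]

open MeasureTheory in
/-- The directional derivatives of a holomorphic function of several variables are holomorphic. -/
theorem differentiableAt_fderiv_apply_of_differentiableOn {V : Type*} [NormedAddCommGroup V]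
    [NormedSpace ℂ V] [FiniteDimensional ℂ V] {U : Set V} (hU : IsOpen U) {φ : V → ℂ}
    (hφ : DifferentiableOn ℂ φ U) {z : V} (hz : z ∈ U) (η : V) :
    DifferentiableAt ℂ (fun x => fderiv ℂ φ x η) z := by
  obtain ⟨R, hR, hRU⟩ : ∃ R > 0, Metric.ball z R ⊆ U ∩ {y | ‖φ y‖ ≤ ‖φ z‖ + 1} := by
    refine Metric.mem_nhds_iff.mp (Filter.inter_mem (hU.mem_nhds hz) ?_)
    have := (hφ.differentiableAt (hU.mem_nhds hz)).continuousAt.norm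
    filter_upwards [this.eventually (gt_mem_nhds (lt_add_one ‖φ z‖))] with y hy using hy.le
  set M := ‖φ z‖ + 1
  have hM : 0 ≤ M := by positivity
  have hdB : DifferentiableOn ℂ φ (Metric.ball z R) := hφ.mono fun y hy => (hRU hy).1
  -- Each point of the half ball is the centre of a ball of radius `R / 2` on which `‖φ‖ ≤ M`,
  -- whence `2M / (R/2)`.
  have hlip : LipschitzOnWith (Real.toNNReal (4 * M / R)) φ (Metric.ball z (R / 2)) := by
    refine Convex.lipschitzOnWith_of_nnnorm_fderiv_le (𝕜 := ℂ) (fun x hx => ?_) (fun x hx => ?_)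
      (convex_ball z (R / 2))
    · exact hdB.differentiableAt
        (Metric.isOpen_ball.mem_nhds (Metric.ball_subset_ball (by linarith) hx))
    · have hsub : Metric.ball x (R / 2) ⊆ Metric.ball z R := by
        refine Metric.ball_subset_ball' ?_
        rw [Metric.mem_ball] at hx
        linarith
      have := norm_fderiv_le_of_norm_le (half_pos hR) (hdB.mono hsub)
        (fun y hy => (hRU (hsub hy)).2)
      rw [← NNReal.coe_le_coe, coe_nnnorm, Real.coe_toNNReal _ (by positivity)]
      refine this.trans_eq ?_
      field_simp
      ring
  -- Circles of this radius around points of the quarter ball stay in the half ball; the summand 1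
  -- covers `η = 0`.
  set r : ℝ := R / (4 * (‖η‖ + 1)) with hr
  have hr0 : 0 < r := by positivity
  have hrη : r * ‖η‖ ≤ R / 4 := by
    rw [hr, div_mul_eq_mul_div, div_le_div_iff₀ (by positivity) (by positivity)]
    nlinarith [norm_nonneg η]
  have hmem : ∀ x ∈ Metric.ball z (R / 4), ∀ t ∈ Metric.closedBall (0 : ℂ) r,
      x + t • η ∈ Metric.ball z (R / 2) := by
    intro x hx t ht
    rw [mem_closedBall_zero_iff] at ht
    rw [mem_ball_iff_norm] at hx ⊢
    calc ‖x + t • η - z‖ = ‖(x - z) + t • η‖ := by congr 1; abel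
      _ ≤ ‖x - z‖ + ‖t‖ * ‖η‖ := (norm_add_le _ _).trans (by rw [norm_smul])
      _ ≤ ‖x - z‖ + r * ‖η‖ := by gcongr
      _ < R / 2 := by linarith
  have hcm : ∀ θ, circleMap 0 r θ ∈ Metric.closedBall (0 : ℂ) r :=
    fun θ => circleMap_mem_closedBall 0 hr0.le θ
  set w : ℝ → ℂ := fun θ => deriv (circleMap 0 r) θ * (circleMap 0 r θ ^ 2)⁻¹ with hw
  have hwc : Continuous w := by
    have h0 : ∀ θ, circleMap 0 r θ ^ 2 ≠ 0 := fun θ => pow_ne_zero 2 (circleMap_ne_center hr0.ne')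
    have : Continuous (circleMap 0 r) := continuous_circleMap 0 r
    simp only [hw, deriv_circleMap]
    exact (this.mul continuous_const).mul ((this.pow 2).inv₀ h0)
  have hφc : ContinuousOn φ (Metric.ball z (R / 2)) := hlip.continuousOn
  have hFc : ∀ x ∈ Metric.ball z (R / 4),
      Continuous fun θ => w θ * φ (x + circleMap 0 r θ • η) := by
    intro x hx
    refine hwc.mul (hφc.comp_continuous ?_ fun θ => hmem x hx _ (hcm θ))
    have : Continuous (circleMap 0 r) := continuous_circleMap 0 r
    fun_prop
  have hz4 : z ∈ Metric.ball z (R / 4) := Metric.mem_ball_self (by positivity)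
  -- Cauchy's formula writes `∂_η φ` as an integral of values of `φ`. Differentiating under the
  -- integral needs only the Lipschitz bound, not continuity of `fderiv ℂ φ`.
  have key := hasFDerivAt_integral_of_dominated_loc_of_lip (𝕜 := ℂ)
    (μ := volume.restrict (Set.Ioc 0 (2 * Real.pi)))
    (F := fun x θ => w θ * φ (x + circleMap 0 r θ • η))
    (F' := fun θ => w θ • fderiv ℂ φ (z + circleMap 0 r θ • η))
    (bound := fun θ => ‖w θ‖ * (4 * M / R)) (x₀ := z) (s := Metric.ball z (R / 4))
    (Metric.ball_mem_nhds z (by positivity)) ?_ ?_ ?_ ?_ ?_ ?_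
  · have hEq : (fun x => fderiv ℂ φ x η) =ᶠ[nhds z] fun x => (2 * Real.pi * I : ℂ)⁻¹ *
        ∫ θ in Set.Ioc 0 (2 * Real.pi), w θ * φ (x + circleMap 0 r θ • η) := by
      filter_upwards [Metric.ball_mem_nhds z (by positivity : 0 < R / 4)] with x hx
      rw [fderiv_apply_eq_circleIntegral hr0 Metric.isOpen_ball
        (hdB.mono (Metric.ball_subset_ball (by linarith))) (hmem x hx), circleIntegral,
        intervalIntegral.integral_of_le Real.two_pi_pos.le, smul_eq_mul]
      simp only [smul_eq_mul, hw, mul_assoc]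
    exact (key.2.differentiableAt.const_mul _).congr_of_eventuallyEq hEq
  · filter_upwards [Metric.ball_mem_nhds z (by positivity : 0 < R / 4)] with x hx
    exact (hFc x hx).aestronglyMeasurable
  · exact ((hFc z hz4).integrableOn_Icc).mono_set Set.Ioc_subset_Icc_self
  · borelize V
    have h1 : Measurable fun θ => fderiv ℂ φ (z + circleMap 0 r θ • η) := by
      refine (measurable_fderiv ℂ φ).comp (Continuous.measurable ?_)
      have : Continuous (circleMap 0 r) := continuous_circleMap 0 r
      fun_prop
    exact (hwc.aestronglyMeasurable).smul h1.stronglyMeasurable.aestronglyMeasurable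
  · refine Filter.Eventually.of_forall fun θ => ?_
    refine LipschitzOnWith.of_dist_le_mul fun x hx y hy => ?_
    have := hlip.dist_le_mul _ (hmem x hx _ (hcm θ)) _ (hmem y hy _ (hcm θ))
    rw [Real.coe_toNNReal _ (by positivity), dist_add_right] at this
    rw [Real.coe_nnabs, abs_of_nonneg (by positivity), dist_eq_norm, ← mul_sub, norm_mul,
      ← dist_eq_norm, mul_assoc]
    gcongr
  · exact ((by fun_prop : Continuous fun θ => ‖w θ‖ * (4 * M / R)).integrableOn_Icc).mono_set
      Set.Ioc_subset_Icc_self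
  · refine Filter.Eventually.of_forall fun θ => ?_
    have hp := hmem z hz4 _ (hcm θ)
    have h2 : HasFDerivAt φ (fderiv ℂ φ (z + circleMap 0 r θ • η)) (z + circleMap 0 r θ • η) :=
      (hdB.differentiableAt (Metric.isOpen_ball.mem_nhds
        (Metric.ball_subset_ball (by linarith) hp))).hasFDerivAt
    have h3 : HasFDerivAt (fun x => φ (x + circleMap 0 r θ • η))
        (fderiv ℂ φ (z + circleMap 0 r θ • η)) z :=
      (hasFDerivAt_comp_add_right (circleMap 0 r θ • η)).mpr h2
    exact h3.const_mul (w θ)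

theorem differentiableAt_fderiv_of_differentiableOn {V : Type*}
    [NormedAddCommGroup V] [NormedSpace ℂ V] [FiniteDimensional ℂ V] {U : Set V} (hU : IsOpen U)
    {φ : V → ℂ} (hφ : DifferentiableOn ℂ φ U) {z : V} (hz : z ∈ U) :
    DifferentiableAt ℂ (fderiv ℂ φ) z := by
  let b := Module.finBasis ℂ V
  have h : fderiv ℂ φ = fun x => ∑ i, fderiv ℂ φ x (b i) •
      LinearMap.toContinuousLinearMap (b.coord i) := by
    ext x v
    conv_lhs => rw [← b.sum_repr v]
    simp only [map_sum, map_smul, sum_apply, smul_apply]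
    simp [mul_comm]
  rw [h]
  refine DifferentiableAt.fun_sum fun i _ => ?_
  exact (differentiableAt_fderiv_apply_of_differentiableOn hU hφ hz (b i)).smul_const _

theorem fderiv_fderiv_apply_comm_of_differentiableOn {V : Type*}
    [NormedAddCommGroup V] [NormedSpace ℂ V] [FiniteDimensional ℂ V] {U : Set V} (hU : IsOpen U)
    {φ : V → ℂ} (hφ : DifferentiableOn ℂ φ U) {z : V} (hz : z ∈ U) (ξ η : V) :
    fderiv ℂ (fun x => fderiv ℂ φ x η) z ξ = fderiv ℂ (fun x => fderiv ℂ φ x ξ) z η := by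
  have hd := differentiableAt_fderiv_of_differentiableOn hU hφ hz
  have h : ∀ η, fderiv ℂ (fun x => fderiv ℂ φ x η) z = (fderiv ℂ (fderiv ℂ φ) z).flip η := by
    intro η
    rw [fderiv_clm_apply hd (differentiableAt_const η)]
    simp
  rw [h, h]
  refine second_derivative_symmetric_of_eventually (𝕜 := ℂ) (f := φ) ?_ hd.hasFDerivAt ξ η
  filter_upwards [hU.mem_nhds hz] with y hy
  exact (hφ.differentiableAt (hU.mem_nhds hy)).hasFDerivAt

/-! ### Commutators of the Dunkl-type operators -/

section DunklCommutators

variable {V : Type*} [NormedAddCommGroup V] [NormedSpace ℂ V]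

theorem rootReflection_eq {B : LinearMap.BilinForm ℂ V} {a : V} (ha : B a a = 2) (z : V) :
    rootReflection B a z = z - B a z • a := by
  rw [rootReflection, ha]
  congr 2
  ring

theorem hasFDerivAt_rootReflection [FiniteDimensional ℂ V] {B : LinearMap.BilinForm ℂ V} {a : V}
    (ha : B a a = 2) (z : V) :
    HasFDerivAt (rootReflection B a)
      (ContinuousLinearMap.id ℂ V - (LinearMap.toContinuousLinearMap (B a)).smulRight a) z := by
  have h : rootReflection B a =
      ⇑(ContinuousLinearMap.id ℂ V - (LinearMap.toContinuousLinearMap (B a)).smulRight a) := by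
    funext x
    simp [rootReflection_eq ha]
  rw [h]
  exact ContinuousLinearMap.hasFDerivAt _

theorem hasFDerivAt_bilinForm_apply_left [FiniteDimensional ℂ V] (B : LinearMap.BilinForm ℂ V)
    (a z : V) :
    HasFDerivAt (fun x => B x a) (LinearMap.toContinuousLinearMap (B.flip a)) z :=
  (LinearMap.toContinuousLinearMap (B.flip a)).hasFDerivAt

/-- Product and chain rule: `s_a` has constant derivative `ξ ↦ ξ - (a,ξ)a`, which produces the
derivatives of `φ` at `s_a z` along `ξ` and along `a`. -/
theorem dunklXi_dunklXi_apply [FiniteDimensional ℂ V] {B : LinearMap.BilinForm ℂ V}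
    (hB : B.IsSymm) {α β : V}
    (hn : ∀ j, B (a2Vectors α β j) (a2Vectors α β j) = 2) (k : V → ℂ) {τ : ℂ} (hτ : 0 < τ.im)
    (a : ℤ) {b : ℤ} (hb : DifferentiableOn ℂ (dunklCoeff τ b) (periodLattice τ)ᶜ)
    {U : Set V} (hU : IsOpen U) (hUr : U ⊆ a2Regular B α β τ)
    (hUs : ∀ i, Set.MapsTo (rootReflection B (a2Vectors α β i)) U U)
    {φ : V → ℂ} (hφ : DifferentiableOn ℂ φ U) (ξ η : V) {z : V} (hz : z ∈ U) :
    dunklXi B α β k τ a ξ (dunklXi B α β k τ b η φ) z =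
      fderiv ℂ (fun x => fderiv ℂ φ x η) z ξ +
      ∑ j, k (a2Vectors α β j) * B (a2Vectors α β j) η *
        (deriv (dunklCoeff τ b) (B z (a2Vectors α β j)) * B (a2Vectors α β j) ξ *
            φ (rootReflection B (a2Vectors α β j) z) +
          dunklCoeff τ b (B z (a2Vectors α β j)) *
            (fderiv ℂ φ (rootReflection B (a2Vectors α β j) z) ξ - B (a2Vectors α β j) ξ *
              fderiv ℂ φ (rootReflection B (a2Vectors α β j) z) (a2Vectors α β j))) +
      ∑ i, k (a2Vectors α β i) * B (a2Vectors α β i) ξ * dunklCoeff τ a (B z (a2Vectors α β i)) *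
        (fderiv ℂ φ (rootReflection B (a2Vectors α β i) z) η +
          ∑ j, k (a2Vectors α β j) * B (a2Vectors α β j) η *
            dunklCoeff τ b (B (rootReflection B (a2Vectors α β i) z) (a2Vectors α β j)) *
            φ (rootReflection B (a2Vectors α β j) (rootReflection B (a2Vectors α β i) z))) := by
  have hder : HasFDerivAt (dunklXi B α β k τ b η φ)
      (fderiv ℂ (fun x => fderiv ℂ φ x η) z + ∑ j, (
        (k (a2Vectors α β j) * B (a2Vectors α β j) η * dunklCoeff τ b (B z (a2Vectors α β j))) •
          ((fderiv ℂ φ (rootReflection B (a2Vectors α β j) z)).comp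
            (ContinuousLinearMap.id ℂ V -
              (LinearMap.toContinuousLinearMap (B (a2Vectors α β j))).smulRight
                (a2Vectors α β j))) +
        φ (rootReflection B (a2Vectors α β j) z) •
          ((k (a2Vectors α β j) * B (a2Vectors α β j) η) •
            (deriv (dunklCoeff τ b) (B z (a2Vectors α β j)) •
              LinearMap.toContinuousLinearMap (B.flip (a2Vectors α β j)))))) z := by
    refine HasFDerivAt.add
      (differentiableAt_fderiv_apply_of_differentiableOn hU hφ hz η).hasFDerivAt
      (HasFDerivAt.fun_sum fun j _ => ?_)
    have h1 : HasFDerivAt (fun x => φ (rootReflection B (a2Vectors α β j) x)) _ z :=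
      ((hφ.differentiableAt (hU.mem_nhds (hUs j hz))).hasFDerivAt).comp z
        (hasFDerivAt_rootReflection (hn j) z)
    have h2 : HasDerivAt (dunklCoeff τ b) _ (B z (a2Vectors α β j)) :=
      (hb.differentiableAt ((isOpen_compl_periodLattice hτ).mem_nhds (hUr hz j))).hasDerivAt
    have h3 := h2.comp_hasFDerivAt z (hasFDerivAt_bilinForm_apply_left B (a2Vectors α β j) z)
    exact (h3.const_mul _).mul h1
  rw [dunklXi, hder.fderiv]
  congr 1
  simp only [add_apply, sum_apply, smul_apply, smul_eq_mul, ContinuousLinearMap.comp_apply,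
    sub_apply, ContinuousLinearMap.id_apply, ContinuousLinearMap.smulRight_apply,
    LinearMap.coe_toContinuousLinearMap', LinearMap.BilinForm.flip_apply, map_sub, map_smul]
  congr 1
  refine Finset.sum_congr rfl fun j _ => ?_
  rw [hB.eq ξ]
  ring

/-- The first and second order terms cancel in `𝔽^{(a,b)}(ξ,η)`. -/
theorem dunklF_apply [FiniteDimensional ℂ V] {B : LinearMap.BilinForm ℂ V}
    (hB : B.IsSymm) {α β : V}
    (hn : ∀ j, B (a2Vectors α β j) (a2Vectors α β j) = 2) (k : V → ℂ) {τ : ℂ} (hτ : 0 < τ.im)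
    {a b : ℤ} (ha : DifferentiableOn ℂ (dunklCoeff τ a) (periodLattice τ)ᶜ)
    (hb : DifferentiableOn ℂ (dunklCoeff τ b) (periodLattice τ)ᶜ)
    {U : Set V} (hU : IsOpen U) (hUr : U ⊆ a2Regular B α β τ)
    (hUs : ∀ i, Set.MapsTo (rootReflection B (a2Vectors α β i)) U U)
    {φ : V → ℂ} (hφ : DifferentiableOn ℂ φ U) (ξ η : V) {z : V} (hz : z ∈ U) :
    dunklF B α β k τ a b ξ η φ z =
      ∑ i, ∑ j, k (a2Vectors α β i) * k (a2Vectors α β j) *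
        (B (a2Vectors α β i) ξ * B (a2Vectors α β j) η -
          B (a2Vectors α β i) η * B (a2Vectors α β j) ξ) *
        (dunklCoeff τ a (B z (a2Vectors α β i)) *
            dunklCoeff τ b (B (rootReflection B (a2Vectors α β i) z) (a2Vectors α β j)) +
          dunklCoeff τ b (B z (a2Vectors α β i)) *
            dunklCoeff τ a (B (rootReflection B (a2Vectors α β i) z) (a2Vectors α β j))) *
        φ (rootReflection B (a2Vectors α β j) (rootReflection B (a2Vectors α β i) z)) := by
  -- The four products form an antisymmetrisation in `ξ, η`. The terms `(a,ξ)(a,η)` are symmetric,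
  -- and so are the first-order terms once the contributions of `a, b` and `b, a` are added; the
  -- second derivatives of `φ` commute.
  simp only [dunklF, opCommutator, Pi.add_apply, Pi.sub_apply]
  rw [dunklXi_dunklXi_apply hB hn k hτ a hb hU hUr hUs hφ ξ η hz,
    dunklXi_dunklXi_apply hB hn k hτ b ha hU hUr hUs hφ η ξ hz,
    dunklXi_dunklXi_apply hB hn k hτ b ha hU hUr hUs hφ ξ η hz,
    dunklXi_dunklXi_apply hB hn k hτ a hb hU hUr hUs hφ η ξ hz,
    fderiv_fderiv_apply_comm_of_differentiableOn hU hφ hz ξ η]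
  simp only [Fin.sum_univ_three]
  ring

end DunklCommutators

/-! ### Eisenstein summation with half signs -/

/-- Half of the sign of an integer, with `0` counted as positive. -/
noncomputable def halfSign (n : ℤ) : ℂ := if 0 ≤ n then 1 / 2 else -1 / 2

theorem halfSign_of_nonneg {n : ℤ} (hn : 0 ≤ n) : halfSign n = 1 / 2 := if_pos hn

theorem halfSign_of_neg {n : ℤ} (hn : n < 0) : halfSign n = -1 / 2 := if_neg (by omega)

theorem halfSign_neg_sub_one (n : ℤ) : halfSign (-n - 1) = -halfSign n := by
  rcases le_or_gt 0 n with h | h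
  · rw [halfSign_of_nonneg h, halfSign_of_neg (by omega)]; ring
  · rw [halfSign_of_neg h, halfSign_of_nonneg (by omega)]; ring

theorem halfSign_add_sub_of_nonneg {n : ℤ} (hn : 0 ≤ n) (m : ℤ) :
    halfSign (n + m) - halfSign m = if m ∈ Finset.Ico (-n) 0 then 1 else 0 := by
  simp only [Finset.mem_Ico]
  split_ifs with h
  · rw [halfSign_of_nonneg (by omega), halfSign_of_neg h.2]; norm_num
  · rcases le_or_gt 0 m with h' | h'
    · rw [halfSign_of_nonneg h', halfSign_of_nonneg (by omega), sub_self]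
    · rw [halfSign_of_neg h', halfSign_of_neg (by omega), sub_self]

theorem halfSign_add_sub_of_neg {n : ℤ} (hn : n < 0) (m : ℤ) :
    halfSign (n + m) - halfSign m = if m ∈ Finset.Ico 0 (-n) then -1 else 0 := by
  simp only [Finset.mem_Ico]
  split_ifs with h
  · rw [halfSign_of_nonneg h.1, halfSign_of_neg (by omega)]; norm_num
  · rcases le_or_gt 0 m with h' | h'
    · rw [halfSign_of_nonneg h', halfSign_of_nonneg (by omega), sub_self]
    · rw [halfSign_of_neg h', halfSign_of_neg (by omega), sub_self]

theorem hasSum_ite_mem_finset {E : Type*} [AddCommMonoid E] [TopologicalSpace E] {ι : Type*}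
    [DecidableEq ι] (s : Finset ι) (c : E) :
    HasSum (fun m => if m ∈ s then c else 0) (s.card • c) := by
  have := hasSum_sum_of_ne_finset_zero (f := fun m => if m ∈ s then c else 0)
    (s := s) (L := SummationFilter.unconditional ι) fun m hm => if_neg hm
  rwa [Finset.sum_congr rfl fun m hm => if_pos hm, Finset.sum_const] at this

/-- The difference lives on the `|n|` integers `m` for which `m` and `n + m` lie on different sides
of the jump, and equals the sign of `n` there. -/
theorem hasSum_halfSign_add_sub (n : ℤ) :
    HasSum (fun m => halfSign (n + m) - halfSign m) (n : ℂ) := by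
  rcases le_or_gt 0 n with h | h
  · simp only [halfSign_add_sub_of_nonneg h]
    convert hasSum_ite_mem_finset (Finset.Ico (-n) 0) (1 : ℂ) using 1
    obtain ⟨k, rfl⟩ := Int.eq_ofNat_of_zero_le h
    simp
  · simp only [halfSign_add_sub_of_neg h]
    convert hasSum_ite_mem_finset (Finset.Ico 0 (-n)) (-1 : ℂ) using 1
    obtain ⟨k, hk⟩ := Int.eq_ofNat_of_zero_le (by omega : 0 ≤ -n)
    obtain rfl : n = -k := by omega
    simp

theorem hasSum_norm_halfSign_add_sub (n : ℤ) :
    HasSum (fun m => ‖halfSign (n + m) - halfSign m‖) |(n : ℝ)| := by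
  rcases le_or_gt 0 n with h | h
  · simp only [halfSign_add_sub_of_nonneg h, apply_ite norm, norm_one, norm_zero]
    convert hasSum_ite_mem_finset (Finset.Ico (-n) 0) (1 : ℝ) using 1
    obtain ⟨k, rfl⟩ := Int.eq_ofNat_of_zero_le h
    simp
  · simp only [halfSign_add_sub_of_neg h, apply_ite norm, norm_neg, norm_one, norm_zero]
    convert hasSum_ite_mem_finset (Finset.Ico 0 (-n)) (1 : ℝ) using 1
    obtain ⟨k, hk⟩ := Int.eq_ofNat_of_zero_le (by omega : 0 ≤ -n)
    obtain rfl : n = -k := by omega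
    simp

/-- Summation over the first coordinate of a double series weighted by sign changes. -/
theorem hasSum_mul_halfSign_sub {c : ℤ → ℂ} (hc : Summable fun n : ℤ => ‖(n : ℂ) * c n‖) :
    HasSum (fun x : ℤ × ℤ => c x.1 * (halfSign (x.1 + x.2) - halfSign x.2))
      (∑' n : ℤ, (n : ℂ) * c n) := by
  have hs : Summable fun x : ℤ × ℤ => c x.1 * (halfSign (x.1 + x.2) - halfSign x.2) := by
    refine Summable.of_norm ((summable_prod_of_nonneg fun _ => norm_nonneg _).mpr ⟨fun n => ?_, ?_⟩)
    · simp only [norm_mul]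
      exact (hasSum_norm_halfSign_add_sub n).summable.mul_left _
    · simp only [norm_mul, tsum_mul_left, (hasSum_norm_halfSign_add_sub _).tsum_eq]
      refine hc.congr fun n => ?_
      rw [norm_mul, mul_comm, norm_intCast]
  have h := hs.tsum_prod
  simp only [tsum_mul_left, (hasSum_halfSign_add_sub _).tsum_eq] at h
  rw [tsum_congr fun n : ℤ => mul_comm (n : ℂ) (c n), ← h]
  exact hs.hasSum

/-- Eisenstein's summation of the addition formula of the cotangent over a lattice: the functions
`P = s + p`, `Q = s + q`, `R = s + r` on `ℤ`, where `s` is half the sign, satisfy it termwise. -/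
theorem tsum_mul_tsum_of_addition {p q r : ℤ → ℂ}
    (hp : Summable fun n => ‖p n‖) (hq : Summable fun n => ‖q n‖) (hr : Summable fun n => ‖r n‖)
    (hp' : Summable fun n : ℤ => ‖(n : ℂ) * p n‖) (hq' : Summable fun n : ℤ => ‖(n : ℂ) * q n‖)
    (hr' : Summable fun n : ℤ => ‖(n : ℂ) * r n‖)
    (h : ∀ n m, (halfSign n + p n) * (halfSign m + q m) -
      (halfSign n + p n + (halfSign m + q m)) * (halfSign (n + m) + r (n + m)) = -1 / 4) :
    (∑' n, p n) * (∑' n, q n) - (∑' n, p n) * (∑' n, r n) - (∑' n, q n) * (∑' n, r n) =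
      (∑' n : ℤ, (n : ℂ) * p n) + (∑' n : ℤ, (n : ℂ) * q n) + (∑' n : ℤ, (n : ℂ) * r n) +
        ∑' n, r n := by
  have hmul : ∀ {u v : ℤ → ℂ}, Summable (fun n => ‖u n‖) → Summable (fun n => ‖v n‖) →
      HasSum (fun x : ℤ × ℤ => u x.1 * v x.2) ((∑' n, u n) * ∑' n, v n) := fun hu hv => by
    rw [tsum_mul_tsum_of_summable_norm hu hv]
    exact (summable_mul_of_summable_norm hu hv).hasSum
  let e1 : ℤ × ℤ ≃ ℤ × ℤ :=
    ⟨fun x => (x.1, x.1 + x.2), fun x => (x.1, x.2 - x.1), fun x => by simp, fun x => by simp⟩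
  let e2 : ℤ × ℤ ≃ ℤ × ℤ :=
    ⟨fun x => (x.2, x.1 + x.2), fun x => (x.2 - x.1, x.1), fun x => by simp, fun x => by simp⟩
  -- With `N = n + m + 1` and `k = -m - 1` one has `N + k = n` and `s(k) = -s(m)`, so `s(n) + s(m) =
  -- s(N + k) - s(k)` fits `hasSum_mul_halfSign_sub`. The shift by one yields the extra `∑ r`.
  let e3 : ℤ × ℤ ≃ ℤ × ℤ :=
    ⟨fun x => (x.1 + x.2 + 1, -x.2 - 1), fun x => (x.1 + x.2, -x.2 - 1),
      fun x => by ext <;> simp, fun x => by ext <;> simp; ring⟩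
  have hpq := hmul hp hq
  have hpr : HasSum (fun x : ℤ × ℤ => p x.1 * r (x.1 + x.2)) _ :=
    (e1.hasSum_iff.mpr (hmul hp hr)).congr_fun fun x => rfl
  have hqr : HasSum (fun x : ℤ × ℤ => q x.2 * r (x.1 + x.2)) _ :=
    (e2.hasSum_iff.mpr (hmul hq hr)).congr_fun fun x => rfl
  have hA := hasSum_mul_halfSign_sub hp'
  have hB : HasSum (fun x : ℤ × ℤ => q x.2 * (halfSign (x.2 + x.1) - halfSign x.1))
      (∑' n : ℤ, (n : ℂ) * q n) :=
    ((Equiv.prodComm ℤ ℤ).hasSum_iff.mpr (hasSum_mul_halfSign_sub hq')).congr_fun fun x => rfl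
  have hsplit : ∀ n : ℤ, ((n + 1 : ℤ) : ℂ) * r n = (n : ℂ) * r n + r n := fun n => by
    push_cast; ring
  have hr1 : Summable fun n : ℤ => ‖((n + 1 : ℤ) : ℂ) * r n‖ := by
    refine Summable.of_nonneg_of_le (fun _ => norm_nonneg _) (fun n => ?_) (hr'.add hr)
    rw [hsplit]
    exact norm_add_le _ _
  have hr2 : Summable fun n : ℤ => ‖(n : ℂ) * r (n - 1)‖ := by
    rw [← (Equiv.addRight (1 : ℤ)).summable_iff]
    refine hr1.congr fun n => ?_
    change _ = ‖((n + 1 : ℤ) : ℂ) * r (n + 1 - 1)‖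
    rw [add_sub_cancel_right]
  have htr : ∑' n : ℤ, (n : ℂ) * r (n - 1) = (∑' n : ℤ, (n : ℂ) * r n) + ∑' n, r n := by
    rw [← (Equiv.addRight (1 : ℤ)).tsum_eq, ← Summable.tsum_add hr'.of_norm hr.of_norm]
    exact tsum_congr fun n => by simp [add_mul]
  have hC : HasSum (fun x : ℤ × ℤ => r (x.1 + x.2 + 1 - 1) *
      (halfSign (x.1 + x.2 + 1 + (-x.2 - 1)) - halfSign (-x.2 - 1)))
      (∑' n : ℤ, (n : ℂ) * r (n - 1)) :=
    (e3.hasSum_iff.mpr (hasSum_mul_halfSign_sub (c := fun n => r (n - 1)) hr2)).congr_fun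
      fun x => rfl
  have hterm : ∀ x : ℤ × ℤ, p x.1 * q x.2 - p x.1 * r (x.1 + x.2) - q x.2 * r (x.1 + x.2) =
      p x.1 * (halfSign (x.1 + x.2) - halfSign x.2) +
        q x.2 * (halfSign (x.2 + x.1) - halfSign x.1) + r (x.1 + x.2 + 1 - 1) *
          (halfSign (x.1 + x.2 + 1 + (-x.2 - 1)) - halfSign (-x.2 - 1)) := by
    intro x
    -- The half signs satisfy the same identity, and at `(0, 0)` this requires counting zero as
    -- positive. Subtraction removes `-1/4` and leaves absolutely summable terms.
    have hs : halfSign x.1 * halfSign x.2 -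
        (halfSign x.1 + halfSign x.2) * halfSign (x.1 + x.2) = -1 / 4 := by
      rcases le_or_gt 0 x.1 with h1 | h1 <;> rcases le_or_gt 0 x.2 with h2 | h2
      · rw [halfSign_of_nonneg h1, halfSign_of_nonneg h2, halfSign_of_nonneg (by omega)]; norm_num
      · rw [halfSign_of_nonneg h1, halfSign_of_neg h2]; norm_num
      · rw [halfSign_of_neg h1, halfSign_of_nonneg h2]; norm_num
      · rw [halfSign_of_neg h1, halfSign_of_neg h2, halfSign_of_neg (by omega)]; norm_num
    have e : x.1 + x.2 + 1 + (-x.2 - 1) = x.1 := by ring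
    rw [halfSign_neg_sub_one, e, add_sub_cancel_right, add_comm x.2 x.1]
    linear_combination h x.1 x.2 - hs
  rw [((hpq.sub hpr).sub hqr).unique (((hA.add hB).add hC).congr_fun hterm), htr]
  ring

/-! ### The Eisenstein-Kronecker series and their addition formula -/

/-- `ζ / (1 - ζ)` for `ζ = e^{2πiu}`. -/
noncomputable def geomExp (u : ℂ) : ℂ :=
  exp (2 * Real.pi * I * u) / (1 - exp (2 * Real.pi * I * u))

theorem exp_two_pi_I_mul_eq_one_iff (u : ℂ) :
    exp (2 * Real.pi * I * u) = 1 ↔ ∃ m : ℤ, u = m := by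
  rw [exp_eq_one_iff]
  have := two_pi_I_ne_zero
  constructor
  · rintro ⟨m, hm⟩
    exact ⟨m, mul_left_cancel₀ this (by linear_combination hm)⟩
  · rintro ⟨m, rfl⟩
    exact ⟨m, by ring⟩

theorem norm_exp_two_pi_I_mul (u : ℂ) :
    ‖exp (2 * Real.pi * I * u)‖ = Real.exp (-(2 * Real.pi * u.im)) := by
  rw [norm_exp]
  congr 1
  simp

theorem norm_geomExp_le {u : ℂ} (hu : Real.exp (-(2 * Real.pi * u.im)) ≤ 1 / 2) :
    ‖geomExp u‖ ≤ 2 * Real.exp (-(2 * Real.pi * u.im)) := by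
  rw [← norm_exp_two_pi_I_mul] at hu ⊢
  rw [geomExp, norm_div]
  have h1 : 1 / 2 ≤ ‖1 - exp (2 * Real.pi * I * u)‖ := by
    have := norm_sub_norm_le (1 : ℂ) (exp (2 * Real.pi * I * u))
    rw [norm_one] at this
    linarith
  rw [div_le_iff₀ (by linarith)]
  nlinarith [norm_nonneg (exp (2 * Real.pi * I * u))]

theorem differentiableAt_geomExp {u : ℂ} (hu : ∀ m : ℤ, u ≠ m) :
    DifferentiableAt ℂ geomExp u := by
  have h : 1 - exp (2 * Real.pi * I * u) ≠ 0 := fun h =>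
    absurd ((exp_two_pi_I_mul_eq_one_iff u).mp (sub_eq_zero.mp h).symm) (by simpa using hu)
  unfold geomExp
  exact DifferentiableAt.div (by fun_prop) (by fun_prop) h

/-- The terms of the Eisenstein-Kronecker series. -/
noncomputable def kroneckerTerm (τ : ℂ) (n : ℤ) (z : ℂ) : ℂ :=
  if 0 ≤ n then geomExp (n * τ + z) else -geomExp (-n * τ - z)

theorem kroneckerTerm_of_nonneg {n : ℤ} (hn : 0 ≤ n) (τ z : ℂ) :
    kroneckerTerm τ n z = geomExp (n * τ + z) := if_pos hn

theorem kroneckerTerm_of_neg {n : ℤ} (hn : n < 0) (τ z : ℂ) :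
    kroneckerTerm τ n z = -geomExp (-n * τ - z) := if_neg (by omega)

/-- The first Eisenstein-Kronecker series: up to a factor the logarithmic derivative of the odd
Jacobi theta function. -/
noncomputable def kroneckerOne (τ z : ℂ) : ℂ := 1 / 2 + ∑' n : ℤ, kroneckerTerm τ n z

/-- The derivative in `τ` of the logarithm of the odd Jacobi theta function. -/
noncomputable def kroneckerTwo (τ z : ℂ) : ℂ := ∑' n : ℤ, (n : ℂ) * kroneckerTerm τ n z - 1 / 12

/-- In both branches the argument of `geomExp` has imaginary part at least `|n| Im τ - M`, and
`|ζ/(1-ζ)| ≤ 2|ζ|` once `|ζ| ≤ 1/2`. -/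
theorem norm_kroneckerTerm_le {τ z : ℂ} {n : ℤ} {M : ℝ} (hM : |z.im| ≤ M)
    (hn : Real.exp (2 * Real.pi * M) * Real.exp (-(2 * Real.pi * τ.im)) ^ n.natAbs ≤ 1 / 2) :
    ‖kroneckerTerm τ n z‖ ≤
      2 * (Real.exp (2 * Real.pi * M) * Real.exp (-(2 * Real.pi * τ.im)) ^ n.natAbs) := by
  have key : ∀ u : ℂ, |(n : ℝ)| * τ.im - M ≤ u.im → ‖geomExp u‖ ≤
      2 * (Real.exp (2 * Real.pi * M) * Real.exp (-(2 * Real.pi * τ.im)) ^ n.natAbs) := by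
    intro u hu
    have h1 : Real.exp (-(2 * Real.pi * u.im)) ≤
        Real.exp (2 * Real.pi * M) * Real.exp (-(2 * Real.pi * τ.im)) ^ n.natAbs := by
      rw [← Real.exp_nat_mul, ← Real.exp_add, Real.exp_le_exp, Nat.cast_natAbs, Int.cast_abs]
      nlinarith [Real.pi_pos]
    exact (norm_geomExp_le (h1.trans hn)).trans (by gcongr)
  have hz := abs_le.mp hM
  rcases le_or_gt 0 n with h | h
  · rw [kroneckerTerm_of_nonneg h]
    refine key _ ?_
    rw [abs_of_nonneg (by exact_mod_cast h)]
    simp only [add_im, mul_im, intCast_re, intCast_im, zero_mul, add_zero]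
    linarith
  · rw [kroneckerTerm_of_neg h, norm_neg]
    refine key _ ?_
    rw [abs_of_neg (by exact_mod_cast h)]
    simp only [sub_im, mul_im, neg_re, neg_im, intCast_re, intCast_im, neg_zero, zero_mul, add_zero]
    linarith

theorem summable_int_pow_natAbs {r : ℝ} (h0 : 0 ≤ r) (h1 : r < 1) (j : ℕ) :
    Summable fun n : ℤ => |(n : ℝ)| ^ j * r ^ n.natAbs := by
  have h := summable_pow_mul_geometric_of_norm_lt_one j (r := r) (by rwa [Real.norm_of_nonneg h0])
  refine Summable.of_nat_of_neg ?_ ?_ <;> simpa using h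

theorem eventually_cofinite_mul_pow_natAbs_le {r : ℝ} (h0 : 0 ≤ r) (h1 : r < 1) (C : ℝ) :
    ∀ᶠ n : ℤ in Filter.cofinite, C * r ^ n.natAbs ≤ 1 / 2 := by
  have h : Summable fun n : ℤ => C * r ^ n.natAbs := by
    simpa using (summable_int_pow_natAbs h0 h1 0).mul_left C
  exact (h.tendsto_cofinite_zero.eventually (gt_mem_nhds (by norm_num : (0 : ℝ) < 1 / 2))).mono
    fun n hn => hn.le

theorem exp_neg_two_pi_mul_lt_one {y : ℝ} (hy : 0 < y) : Real.exp (-(2 * Real.pi * y)) < 1 := by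
  rw [Real.exp_lt_one_iff]
  have := Real.pi_pos
  nlinarith [mul_pos this hy]

/-- Finitely many terms, which may have poles in the strip, are left out. Uniformity in the strip
gives uniformity on compact sets. -/
theorem exists_summable_bound_kroneckerTerm {τ : ℂ} (hτ : 0 < τ.im) (M : ℝ) (j : ℕ) :
    ∃ u : ℤ → ℝ, Summable u ∧ ∀ᶠ n : ℤ in Filter.cofinite, ∀ z : ℂ, |z.im| ≤ M →
      ‖(n : ℂ) ^ j * kroneckerTerm τ n z‖ ≤ u n := by
  have h0 := (Real.exp_pos (-(2 * Real.pi * τ.im))).le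
  have h1 := exp_neg_two_pi_mul_lt_one hτ
  refine ⟨_, (summable_int_pow_natAbs h0 h1 j).mul_left (2 * Real.exp (2 * Real.pi * M)), ?_⟩
  filter_upwards [eventually_cofinite_mul_pow_natAbs_le h0 h1 (Real.exp (2 * Real.pi * M))]
    with n hn z hz
  rw [norm_mul, norm_pow, norm_intCast]
  calc _ ≤ |(n : ℝ)| ^ j * _ :=
        mul_le_mul_of_nonneg_left (norm_kroneckerTerm_le hz hn) (by positivity)
    _ = _ := by ring

theorem summable_norm_pow_mul_kroneckerTerm {τ : ℂ} (hτ : 0 < τ.im) (z : ℂ) (j : ℕ) :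
    Summable fun n : ℤ => ‖(n : ℂ) ^ j * kroneckerTerm τ n z‖ := by
  obtain ⟨u, hu, h⟩ := exists_summable_bound_kroneckerTerm hτ |z.im| j
  refine Summable.of_norm_bounded_eventually hu ?_
  filter_upwards [h] with n hn
  rw [norm_norm]
  exact hn z le_rfl

theorem summable_norm_kroneckerTerm {τ : ℂ} (hτ : 0 < τ.im) (z : ℂ) :
    Summable fun n : ℤ => ‖kroneckerTerm τ n z‖ := by
  simpa only [pow_zero, one_mul] using summable_norm_pow_mul_kroneckerTerm hτ z 0

theorem summable_norm_mul_kroneckerTerm {τ : ℂ} (hτ : 0 < τ.im) (z : ℂ) :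
    Summable fun n : ℤ => ‖(n : ℂ) * kroneckerTerm τ n z‖ := by
  simpa only [pow_one] using summable_norm_pow_mul_kroneckerTerm hτ z 1

theorem int_mul_add_ne_intCast {τ z : ℂ} (hz : z ∉ periodLattice τ) (n m : ℤ) :
    n * τ + z ≠ m := fun h => hz ⟨m, -n, by push_cast; linear_combination h⟩

theorem differentiableAt_kroneckerTerm {τ z : ℂ} (hz : z ∉ periodLattice τ) (n : ℤ) :
    DifferentiableAt ℂ (kroneckerTerm τ n) z := by
  rcases le_or_gt 0 n with h | h
  · have : kroneckerTerm τ n = fun z => geomExp (n * τ + z) :=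
      funext fun z => kroneckerTerm_of_nonneg h τ z
    rw [this]
    exact (differentiableAt_geomExp (int_mul_add_ne_intCast hz n)).comp z (by fun_prop)
  · have : kroneckerTerm τ n = fun z => -geomExp (-n * τ - z) :=
      funext fun z => kroneckerTerm_of_neg h τ z
    rw [this]
    have hne : ∀ m : ℤ, -n * τ - z ≠ m := fun m hm =>
      int_mul_add_ne_intCast hz n (-m) (by push_cast; linear_combination -hm)
    exact ((differentiableAt_geomExp hne).comp z (by fun_prop)).neg

theorem differentiableOn_tsum_pow_mul_kroneckerTerm {τ : ℂ} (hτ : 0 < τ.im) (j : ℕ) :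
    DifferentiableOn ℂ (fun z => ∑' n : ℤ, (n : ℂ) ^ j * kroneckerTerm τ n z)
      (periodLattice τ)ᶜ := by
  have ho := isOpen_compl_periodLattice hτ
  refine SummableLocallyUniformlyOn.differentiableOn ho
    (.of_locally_bounded_eventually ho fun K _ hK => ?_)
    fun n z hz => (differentiableAt_kroneckerTerm hz n).const_mul _
  obtain ⟨M, hM⟩ := hK.exists_bound_of_continuousOn (f := Complex.im) continuous_im.continuousOn
  obtain ⟨u, hu, h⟩ := exists_summable_bound_kroneckerTerm hτ M j
  exact ⟨u, hu, h.mono fun n hn z hz => hn z (hM z hz)⟩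

theorem differentiableOn_kroneckerOne {τ : ℂ} (hτ : 0 < τ.im) :
    DifferentiableOn ℂ (kroneckerOne τ) (periodLattice τ)ᶜ := by
  have := (differentiableOn_tsum_pow_mul_kroneckerTerm hτ 0).const_add (1 / 2 : ℂ)
  exact this.congr fun z _ => by simp only [kroneckerOne, pow_zero, one_mul]

theorem differentiableOn_kroneckerTwo {τ : ℂ} (hτ : 0 < τ.im) :
    DifferentiableOn ℂ (kroneckerTwo τ) (periodLattice τ)ᶜ := by
  have := (differentiableOn_tsum_pow_mul_kroneckerTerm hτ 1).sub_const (1 / 12 : ℂ)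
  exact this.congr fun z _ => by simp only [kroneckerTwo, pow_one]

/-- The term of index `n`, completed by half the sign of `n`, is a cotangent. -/
theorem halfSign_add_kroneckerTerm {τ z : ℂ} (hz : z ∉ periodLattice τ) (n : ℤ) :
    halfSign n + kroneckerTerm τ n z =
      (1 + exp (2 * Real.pi * I * (n * τ + z))) /
        (2 * (1 - exp (2 * Real.pi * I * (n * τ + z)))) := by
  have h1 : 1 - exp (2 * Real.pi * I * (n * τ + z)) ≠ 0 := fun h => by
    obtain ⟨m, hm⟩ := (exp_two_pi_I_mul_eq_one_iff _).mp (sub_eq_zero.mp h).symm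
    exact int_mul_add_ne_intCast hz n m hm
  rcases le_or_gt 0 n with h | h
  · rw [halfSign_of_nonneg h, kroneckerTerm_of_nonneg h, geomExp]
    field_simp
    ring
  · rw [halfSign_of_neg h, kroneckerTerm_of_neg h, geomExp]
    have e : 2 * Real.pi * I * (-n * τ - z) = -(2 * Real.pi * I * (n * τ + z)) := by ring
    rw [e, exp_neg]
    have h2 := exp_ne_zero (2 * Real.pi * I * (n * τ + z))
    set w := exp (2 * Real.pi * I * (n * τ + z))
    have h3 : w - 1 ≠ 0 := fun h => h1 (by linear_combination -h)
    have h4 : 1 - w⁻¹ = (w - 1) / w := by field_simp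
    rw [h4]
    field_simp
    ring

/-- The addition formula `g(x) g(y) - (g(x) + g(y)) g(x + y) = h(x) + h(y) + h(x + y)`. -/
theorem kroneckerOne_addition {τ : ℂ} (hτ : 0 < τ.im) {x y : ℂ} (hx : x ∉ periodLattice τ)
    (hy : y ∉ periodLattice τ) (hxy : x + y ∉ periodLattice τ) :
    kroneckerOne τ x * kroneckerOne τ y -
        (kroneckerOne τ x + kroneckerOne τ y) * kroneckerOne τ (x + y) =
      kroneckerTwo τ x + kroneckerTwo τ y + kroneckerTwo τ (x + y) := by
  have key := tsum_mul_tsum_of_addition (summable_norm_kroneckerTerm hτ x)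
    (summable_norm_kroneckerTerm hτ y) (summable_norm_kroneckerTerm hτ (x + y))
    (summable_norm_mul_kroneckerTerm hτ x) (summable_norm_mul_kroneckerTerm hτ y)
    (summable_norm_mul_kroneckerTerm hτ (x + y)) ?_
  · simp only [kroneckerOne, kroneckerTwo]
    -- On the left the constants `1/2` contribute `-1/4 - ∑ r`: the `-1/4` matches three times
    -- `-1/12`, and the `∑ r` cancels the extra one in `key`.
    linear_combination key
  · intro n m
    have hne : ∀ {z : ℂ}, z ∉ periodLattice τ → ∀ n : ℤ,
        1 - exp (2 * Real.pi * I * (n * τ + z)) ≠ 0 := fun hz n h => by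
      obtain ⟨m, hm⟩ := (exp_two_pi_I_mul_eq_one_iff _).mp (sub_eq_zero.mp h).symm
      exact int_mul_add_ne_intCast hz n m hm
    have h1 := hne hx n
    have h2 := hne hy m
    have h3 := hne hxy (n + m)
    rw [halfSign_add_kroneckerTerm hx, halfSign_add_kroneckerTerm hy,
      halfSign_add_kroneckerTerm hxy]
    have e : exp (2 * Real.pi * I * ((n + m : ℤ) * τ + (x + y))) =
        exp (2 * Real.pi * I * (n * τ + x)) * exp (2 * Real.pi * I * (m * τ + y)) := by
      rw [← exp_add]
      congr 1
      push_cast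
      ring
    rw [e] at h3 ⊢
    generalize exp (2 * Real.pi * I * (n * τ + x)) = u at h1 h3 ⊢
    generalize exp (2 * Real.pi * I * (m * τ + y)) = v at h2 h3 ⊢
    field_simp
    ring

theorem neg_notMem_periodLattice {τ z : ℂ} (hz : z ∉ periodLattice τ) : -z ∉ periodLattice τ := by
  rintro ⟨m, n, h⟩
  exact hz ⟨-m, -n, by push_cast; linear_combination -h⟩

theorem kroneckerTerm_neg {τ z : ℂ} {n : ℤ} (hn : n ≠ 0) :
    kroneckerTerm τ n (-z) = -kroneckerTerm τ (-n) z := by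
  rcases lt_or_gt_of_ne hn with h | h
  · rw [kroneckerTerm_of_neg h, kroneckerTerm_of_nonneg (by omega)]
    push_cast
    ring_nf
  · rw [kroneckerTerm_of_neg (by omega : -n < 0), kroneckerTerm_of_nonneg h.le]
    push_cast
    ring_nf

/-- The terms of index `n` and `-n` are exchanged, and the exceptional term `n = 0` carries the
factor 0. -/
theorem kroneckerTwo_neg (τ z : ℂ) : kroneckerTwo τ (-z) = kroneckerTwo τ z := by
  rw [kroneckerTwo, kroneckerTwo, ← (Equiv.neg ℤ).tsum_eq fun n : ℤ => (n : ℂ) * kroneckerTerm τ n z]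
  congr 1
  refine tsum_congr fun n => ?_
  rcases eq_or_ne n 0 with rfl | hn
  · simp
  · rw [kroneckerTerm_neg hn]
    simp

/-- Only the term `n = 0` fails to match: `ζ⁻¹/(1-ζ⁻¹) = -ζ/(1-ζ) - 1`. The constant `1/2` absorbs
this `-1`. -/
theorem kroneckerOne_neg {τ z : ℂ} (hτ : 0 < τ.im) (hz : z ∉ periodLattice τ) :
    kroneckerOne τ (-z) = -kroneckerOne τ z := by
  have h0 : kroneckerTerm τ 0 (-z) = -kroneckerTerm τ 0 z - 1 := by
    have h1 := halfSign_add_kroneckerTerm hz 0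
    have h2 := halfSign_add_kroneckerTerm (neg_notMem_periodLattice hz) 0
    have h3 : 1 - exp (2 * Real.pi * I * z) ≠ 0 := fun h => by
      obtain ⟨m, hm⟩ := (exp_two_pi_I_mul_eq_one_iff _).mp (sub_eq_zero.mp h).symm
      exact int_mul_add_ne_intCast hz 0 m (by simpa using hm)
    have h4 := exp_ne_zero (2 * Real.pi * I * z)
    simp only [Int.cast_zero, zero_mul, zero_add, halfSign_of_nonneg le_rfl, mul_neg, exp_neg]
      at h1 h2
    set w := exp (2 * Real.pi * I * z)
    have h5 : w - 1 ≠ 0 := fun h => h3 (by linear_combination -h)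
    have h6 : (1 + w⁻¹) / (2 * (1 - w⁻¹)) = -((1 + w) / (2 * (1 - w))) := by
      have h4 : 1 - w⁻¹ = (w - 1) / w := by field_simp
      rw [h4]
      field_simp
      ring
    linear_combination h1 + h2 + h6
  have hs := (summable_norm_kroneckerTerm hτ z).of_norm
  have hterm : ∀ n, kroneckerTerm τ n (-z) =
      -kroneckerTerm τ (-n) z - if n = 0 then 1 else 0 := by
    intro n
    split_ifs with hn
    · rw [hn, h0, neg_zero]
    · rw [kroneckerTerm_neg hn, sub_zero]
  have hs' : Summable fun n : ℤ => kroneckerTerm τ (-n) z :=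
    hs.comp_injective neg_injective
  have hneg := (Equiv.neg ℤ).tsum_eq fun n : ℤ => kroneckerTerm τ n z
  simp only [Equiv.neg_apply] at hneg
  rw [kroneckerOne, kroneckerOne, tsum_congr hterm,
    Summable.tsum_sub hs'.neg (hasSum_ite_eq 0 1).summable, tsum_neg, tsum_ite_eq, hneg]
  ring

theorem kroneckerTerm_natCast (τ z : ℂ) (n : ℕ) :
    kroneckerTerm τ n z = geomExp (n * τ + z) := by
  rw [kroneckerTerm_of_nonneg (by omega)]
  push_cast
  rfl

theorem kroneckerTerm_neg_natCast_add_one (τ z : ℂ) (n : ℕ) :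
    kroneckerTerm τ (-(n + 1 : ℤ)) z = -geomExp ((n + 1 : ℕ) * τ - z) := by
  rw [kroneckerTerm_of_neg (by omega)]
  push_cast
  rw [neg_neg]

theorem kroneckerOne_eq {τ : ℂ} (hτ : 0 < τ.im) (z : ℂ) :
    kroneckerOne τ z = 1 / 2 + ∑' n : ℕ, geomExp (n * τ + z) -
      ∑' n : ℕ, geomExp ((n + 1 : ℕ) * τ - z) := by
  have hs := (summable_norm_kroneckerTerm hτ z).of_norm
  have h := tsum_of_nat_of_neg_add_one (f := fun n : ℤ => kroneckerTerm τ n z)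
    (hs.comp_injective Nat.cast_injective)
    (hs.comp_injective (i := fun n : ℕ => -(n + 1 : ℤ)) fun a b h => by simpa using h)
  simp only [kroneckerTerm_natCast, kroneckerTerm_neg_natCast_add_one, tsum_neg] at h
  rw [kroneckerOne, h]
  ring

theorem kroneckerTwo_eq {τ : ℂ} (hτ : 0 < τ.im) (z : ℂ) :
    kroneckerTwo τ z = ∑' n : ℕ, (n : ℂ) * geomExp (n * τ + z) +
      ∑' n : ℕ, ((n + 1 : ℕ) : ℂ) * geomExp ((n + 1 : ℕ) * τ - z) - 1 / 12 := by
  have hs := (summable_norm_mul_kroneckerTerm hτ z).of_norm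
  have h := tsum_of_nat_of_neg_add_one (f := fun n : ℤ => (n : ℂ) * kroneckerTerm τ n z)
    (hs.comp_injective Nat.cast_injective)
    (hs.comp_injective (i := fun n : ℕ => -(n + 1 : ℤ)) fun a b h => by simpa using h)
  simp only [kroneckerTerm_natCast, kroneckerTerm_neg_natCast_add_one] at h
  rw [kroneckerTwo, h]
  congr 2
  refine tsum_congr fun n => ?_
  push_cast
  ring

/-! ### Termwise differentiation of the elliptic trilogarithm -/

theorem norm_polylogTerm_le (r n : ℕ) {u : ℂ} {c : ℝ} (hu : c ≤ u.im) :
    ‖exp (2 * Real.pi * I * u) ^ (n + 1) / ((n + 1 : ℕ) : ℂ) ^ r‖ ≤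
      Real.exp (-(2 * Real.pi * c)) ^ (n + 1) := by
  rw [norm_div, norm_pow, norm_pow, norm_natCast, norm_exp_two_pi_I_mul]
  have h1 : (1 : ℝ) ≤ ((n + 1 : ℕ) : ℝ) ^ r := one_le_pow₀ (by simp)
  refine (div_le_self (by positivity) h1).trans ?_
  gcongr

theorem summable_exp_pow_succ {c : ℝ} (hc : 0 < c) :
    Summable fun n : ℕ => Real.exp (-(2 * Real.pi * c)) ^ (n + 1) :=
  (summable_nat_add_iff 1).mpr
    (summable_geometric_of_lt_one (Real.exp_pos _).le (exp_neg_two_pi_mul_lt_one hc))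

theorem hasDerivAt_polylogSeries_exp (r : ℕ) {u : ℂ} (hu : 0 < u.im) :
    HasDerivAt (fun u => polylogSeries (r + 1) (exp (2 * Real.pi * I * u)))
      (2 * Real.pi * I * polylogSeries r (exp (2 * Real.pi * I * u))) u := by
  have hc : 0 < u.im / 2 := half_pos hu
  have key := hasDerivAt_tsum_of_isPreconnected
    (g := fun (n : ℕ) (y : ℂ) =>
      exp (2 * Real.pi * I * y) ^ (n + 1) / ((n + 1 : ℕ) : ℂ) ^ (r + 1))
    (g' := fun (n : ℕ) (y : ℂ) =>
      2 * Real.pi * I * (exp (2 * Real.pi * I * y) ^ (n + 1) / ((n + 1 : ℕ) : ℂ) ^ r))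
    (t := {y : ℂ | u.im / 2 < y.im}) (y₀ := u) (y := u)
    ((summable_exp_pow_succ hc).mul_left ‖(2 * Real.pi * I : ℂ)‖)
    (isOpen_lt continuous_const continuous_im) (convex_halfSpace_im_gt _).isPreconnected
    (fun n y _ => ?_) (fun n y hy => ?_) (by simp [hu]) ?_ (by simp [hu])
  · rw [tsum_mul_left] at key
    exact key
  · have h1 : HasDerivAt (fun y : ℂ => exp (2 * Real.pi * I * y))
        (exp (2 * Real.pi * I * y) * (2 * Real.pi * I)) y := by
      simpa using ((hasDerivAt_id y).const_mul (2 * Real.pi * I : ℂ)).cexp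
    refine ((h1.pow (n + 1)).div_const (((n + 1 : ℕ) : ℂ) ^ (r + 1))).congr_deriv ?_
    have h2 : ((n + 1 : ℕ) : ℂ) ≠ 0 := by exact_mod_cast n.succ_ne_zero
    rw [add_tsub_cancel_right]
    field_simp
    ring
  · rw [norm_mul]
    exact mul_le_mul_of_nonneg_left (norm_polylogTerm_le r n (le_of_lt hy)) (norm_nonneg _)
  · exact Summable.of_norm_bounded (summable_exp_pow_succ hu)
      fun n => norm_polylogTerm_le (r + 1) n le_rfl

/-- The margin `c` keeps the argument away from the unit circle, and `δ`, the growth of the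
imaginary part per step, gives geometric decay in `n`. -/
theorem norm_polylogSeries_exp_le (r : ℕ) {u : ℂ} {c δ : ℝ} (hc : 0 < c) (hδ : 0 < δ) (n : ℕ)
    (hu : c + n * δ ≤ u.im) :
    ‖polylogSeries r (exp (2 * Real.pi * I * u))‖ ≤
      (1 - Real.exp (-(2 * Real.pi * c)))⁻¹ * Real.exp (-(2 * Real.pi * δ)) ^ n := by
  have hnδ : 0 ≤ n * δ := by positivity
  have hu0 : 0 < u.im := by linarith
  have hρ := exp_neg_two_pi_mul_lt_one hc
  have hρ' := exp_neg_two_pi_mul_lt_one hu0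
  have h1 := tsum_of_norm_bounded (summable_exp_pow_succ hu0).hasSum
    fun n => norm_polylogTerm_le r n (le_refl u.im)
  refine h1.trans ?_
  simp only [pow_succ]
  rw [tsum_mul_right, tsum_geometric_of_lt_one (Real.exp_pos _).le hρ']
  have h2 : Real.exp (-(2 * Real.pi * u.im)) ≤ Real.exp (-(2 * Real.pi * δ)) ^ n := by
    rw [← Real.exp_nat_mul, Real.exp_le_exp]
    nlinarith [Real.pi_pos]
  have h3 : Real.exp (-(2 * Real.pi * u.im)) ≤ Real.exp (-(2 * Real.pi * c)) := by
    rw [Real.exp_le_exp]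
    nlinarith [Real.pi_pos]
  have h4 : 0 < 1 - Real.exp (-(2 * Real.pi * c)) := by linarith
  gcongr

/-- Termwise differentiation of a series of polylogarithms along affine families. -/
theorem hasDerivAt_tsum_polylogSeries (r : ℕ) {a b : ℕ → ℂ} (ha : ∀ n, ‖a n‖ ≤ n + 1)
    {S : Set ℂ} (hSo : IsOpen S) (hSc : Convex ℝ S) {c δ : ℝ} (hc : 0 < c) (hδ : 0 < δ)
    (hS : ∀ t ∈ S, ∀ n : ℕ, c + n * δ ≤ (a n * t + b n).im) {t : ℂ} (ht : t ∈ S) :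
    HasDerivAt (fun t => ∑' n, polylogSeries (r + 1) (exp (2 * Real.pi * I * (a n * t + b n))))
      (2 * Real.pi * I *
        ∑' n, a n * polylogSeries r (exp (2 * Real.pi * I * (a n * t + b n)))) t := by
  have h0 := (Real.exp_pos (-(2 * Real.pi * δ))).le
  have h1 := exp_neg_two_pi_mul_lt_one hδ
  have hgeo := summable_geometric_of_lt_one h0 h1
  have hs : Summable fun n : ℕ => ((n : ℝ) + 1) * Real.exp (-(2 * Real.pi * δ)) ^ n := by
    have h := summable_pow_mul_geometric_of_norm_lt_one 1 (by rwa [Real.norm_of_nonneg h0])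
    exact (h.add hgeo).congr fun n => by ring
  have him : ∀ t ∈ S, ∀ n, 0 < (a n * t + b n).im := fun t ht n =>
    (by positivity : 0 < c + n * δ).trans_le (hS t ht n)
  have key := hasDerivAt_tsum_of_isPreconnected
    (g := fun n t => polylogSeries (r + 1) (exp (2 * Real.pi * I * (a n * t + b n))))
    (g' := fun n t => 2 * Real.pi * I *
      (a n * polylogSeries r (exp (2 * Real.pi * I * (a n * t + b n)))))
    (t := S) (y₀ := t) (y := t)
    (hs.mul_left (‖(2 * Real.pi * I : ℂ)‖ * (1 - Real.exp (-(2 * Real.pi * c)))⁻¹))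
    hSo hSc.isPreconnected (fun n t ht => ?_) (fun n t ht => ?_) ht ?_ ht
  · rw [tsum_mul_left] at key
    exact key
  · have hl : HasDerivAt (fun t => a n * t + b n) (a n) t := by
      simpa using ((hasDerivAt_id t).const_mul (a n)).add_const (b n)
    refine ((hasDerivAt_polylogSeries_exp r (him t ht n)).comp t hl).congr_deriv ?_
    ring
  · rw [norm_mul (2 * Real.pi * I : ℂ), norm_mul (a n)]
    calc _ ≤ ‖(2 * Real.pi * I : ℂ)‖ * ((n + 1) * ((1 - Real.exp (-(2 * Real.pi * c)))⁻¹ *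
          Real.exp (-(2 * Real.pi * δ)) ^ n)) := by
          have := norm_polylogSeries_exp_le r hc hδ n (hS t ht n)
          have := ha n
          gcongr
      _ = _ := by ring
  · exact Summable.of_norm_bounded (hgeo.mul_left _)
      fun n => norm_polylogSeries_exp_le (r + 1) hc hδ n (hS t ht n)

theorem polylogSeries_zero_exp {u : ℂ} (hu : 0 < u.im) :
    polylogSeries 0 (exp (2 * Real.pi * I * u)) = geomExp u := by
  have h : ‖exp (2 * Real.pi * I * u)‖ < 1 := by
    rw [norm_exp_two_pi_I_mul]
    exact exp_neg_two_pi_mul_lt_one hu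
  simp only [polylogSeries, pow_zero, div_one, pow_succ]
  rw [tsum_mul_right, tsum_geometric_of_norm_lt_one h, geomExp, div_eq_mul_inv, mul_comm]

/-- `∑_{n ≥ 0} Li_r(q^n ζ)`. -/
noncomputable def polylogSumPos (r : ℕ) (z τ : ℂ) : ℂ :=
  ∑' n : ℕ, polylogSeries r (exp (2 * Real.pi * I * (n * τ + z)))

/-- `∑_{n ≥ 1} Li_r(q^n ζ⁻¹)`. -/
noncomputable def polylogSumNeg (r : ℕ) (z τ : ℂ) : ℂ :=
  ∑' n : ℕ, polylogSeries r (exp (2 * Real.pi * I * ((n + 1 : ℕ) * τ - z)))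

theorem hasDerivAt_polylogSumPos_left (r : ℕ) {z τ : ℂ} (hz : 0 < z.im) (hτ : 0 < τ.im) :
    HasDerivAt (fun z => polylogSumPos (r + 1) z τ) (2 * Real.pi * I * polylogSumPos r z τ) z := by
  have h := hasDerivAt_tsum_polylogSeries r (a := fun _ => 1) (b := fun n => n * τ)
    (fun n => by simp) (isOpen_lt continuous_const continuous_im) (convex_halfSpace_im_gt (z.im / 2))
    (half_pos hz) hτ (fun t ht n => by
      have ht' : z.im / 2 < t.im := ht
      simp only [one_mul, add_im, mul_im, natCast_re, natCast_im, zero_mul, add_zero]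
      linarith) (t := z) (by simpa using hz)
  simp only [one_mul, add_comm _ ((_ : ℂ) * τ)] at h
  exact h

theorem hasDerivAt_polylogSumNeg_left (r : ℕ) {z τ : ℂ} (hzτ : z.im < τ.im) (hτ : 0 < τ.im) :
    HasDerivAt (fun z => polylogSumNeg (r + 1) z τ)
      (-(2 * Real.pi * I * polylogSumNeg r z τ)) z := by
  have h := hasDerivAt_tsum_polylogSeries r (a := fun _ => -1) (b := fun n => (n + 1 : ℕ) * τ)
    (fun n => by simp) (isOpen_lt continuous_im continuous_const)
    (convex_halfSpace_im_lt ((z.im + τ.im) / 2))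
    (c := (τ.im - z.im) / 2) (by linarith) hτ (fun t ht n => by
      have ht' : t.im < (z.im + τ.im) / 2 := ht
      simp only [neg_mul, one_mul, add_im, neg_im, mul_im, natCast_re, natCast_im, zero_mul,
        add_zero]
      push_cast
      linarith) (t := z) (by simp only [Set.mem_ofPred_eq]; linarith)
  simp only [neg_mul, one_mul, neg_add_eq_sub, tsum_neg, mul_neg] at h
  exact h

theorem hasDerivAt_polylogSumPos_right (r : ℕ) {z τ : ℂ} (hz : 0 < z.im) (hτ : 0 < τ.im) :
    HasDerivAt (fun τ => polylogSumPos (r + 1) z τ) (2 * Real.pi * I *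
      ∑' n : ℕ, (n : ℂ) * polylogSeries r (exp (2 * Real.pi * I * (n * τ + z)))) τ :=
  hasDerivAt_tsum_polylogSeries r (a := fun n => n) (b := fun _ => z)
    (fun n => by simp) (isOpen_lt continuous_const continuous_im) (convex_halfSpace_im_gt (τ.im / 2))
    hz (half_pos hτ) (fun t ht n => by
      have ht' : τ.im / 2 < t.im := ht
      simp only [add_im, mul_im, natCast_re, natCast_im, zero_mul, add_zero]
      nlinarith [(Nat.cast_nonneg n : (0 : ℝ) ≤ n)]) (t := τ) (by simpa using hτ)

theorem hasDerivAt_polylogSumNeg_right (r : ℕ) {z τ : ℂ} (hzτ : z.im < τ.im) (hz : 0 < z.im) :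
    HasDerivAt (fun τ => polylogSumNeg (r + 1) z τ) (2 * Real.pi * I *
      ∑' n : ℕ, ((n + 1 : ℕ) : ℂ) *
        polylogSeries r (exp (2 * Real.pi * I * ((n + 1 : ℕ) * τ - z)))) τ := by
  have h := hasDerivAt_tsum_polylogSeries r (a := fun n => (n + 1 : ℕ)) (b := fun _ => -z)
    (fun n => by rw [norm_natCast]; push_cast; exact le_rfl)
    (isOpen_lt continuous_const continuous_im) (convex_halfSpace_im_gt ((z.im + τ.im) / 2))
    -- For `Im t > (Im z + Im τ)/2`, the imaginary part of `(n+1)t - z` exceeds `n(Im z + Im τ)/2 +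
    -- (Im τ - Im z)/2`.
    (c := (τ.im - z.im) / 2) (δ := (z.im + τ.im) / 2) (by linarith) (by linarith)
    (fun t ht n => by
      have ht' : (z.im + τ.im) / 2 < t.im := ht
      simp only [add_im, neg_im, mul_im, natCast_re, natCast_im, zero_mul, add_zero]
      push_cast
      nlinarith [(Nat.cast_nonneg n : (0 : ℝ) ≤ n)])
    (t := τ) (by simp only [Set.mem_ofPred_eq]; linarith)
  simp only [← sub_eq_add_neg] at h
  exact h

/-- The term in `zτ²` is absent as `B₃ = 0`. The `z³` term yields the `1/2` in `kroneckerOne`, the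
`z²τ` term the `-1/12` in `kroneckerTwo`. -/
theorem chiPoly_three (z τ : ℂ) :
    chiPoly 3 z τ = -(2 * Real.pi * I * z) ^ 3 / 12 +
      (2 * Real.pi * I * z) ^ 2 * (2 * Real.pi * I * τ) / 24 -
      (2 * Real.pi * I * τ) ^ 3 / 720 := by
  have h4 : bernoulli 4 = -1 / 30 := by
    rw [bernoulli_eq_bernoulli'_of_ne_one (by norm_num), bernoulli'_four]
  have h3 : bernoulli 3 = 0 := by
    rw [bernoulli_eq_bernoulli'_of_ne_one (by norm_num), bernoulli'_three]
  have h2 : bernoulli 2 = 1 / 6 := by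
    rw [bernoulli_eq_bernoulli'_of_ne_one (by norm_num), bernoulli'_two]
  simp only [chiPoly, Finset.sum_range_succ, Finset.sum_range_zero, zero_add, bernoulli_one, h2, h3,
    h4, Nat.reduceAdd, Nat.reduceSub, Nat.factorial, Nat.sub_self, Nat.sub_zero]
  push_cast
  ring

theorem iteratedDeriv_succ_eqOn {f g g' : ℂ → ℂ} {n : ℕ} {O : Set ℂ} (hO : IsOpen O)
    (h : Set.EqOn (iteratedDeriv n f) g O) (hg : ∀ z ∈ O, HasDerivAt g (g' z) z) :
    Set.EqOn (iteratedDeriv (n + 1) f) g' O := by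
  intro z hz
  rw [iteratedDeriv_succ, (h.eventuallyEq_of_mem (hO.mem_nhds hz)).deriv_eq, (hg z hz).deriv]

theorem isOpen_strip (τ : ℂ) : IsOpen {z : ℂ | 0 < z.im ∧ z.im < τ.im} :=
  (isOpen_lt continuous_const continuous_im).inter (isOpen_lt continuous_im continuous_const)

theorem hasDerivAt_two_pi_I_mul_pow (j : ℕ) (z : ℂ) :
    HasDerivAt (fun z : ℂ => (2 * Real.pi * I * z) ^ (j + 1))
      ((j + 1) * (2 * Real.pi * I * z) ^ j * (2 * Real.pi * I)) z := by
  have h := ((hasDerivAt_id z).const_mul (2 * Real.pi * I : ℂ)).pow (j + 1)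
  exact h.congr_deriv (by simp)

/-- Common source of `f^{(3,0)}` and `f^{(2,1)}`. The subtracted value at `z = 0` is constant in
`z`, so it disappears without any study of its convergence. -/
theorem iteratedDeriv_two_ellTrilog {τ : ℂ} (hτ : 0 < τ.im) :
    Set.EqOn (iteratedDeriv 2 fun w => ellTrilog w τ)
      (fun z => (2 * Real.pi * I)⁻¹ * (polylogSumPos 1 z τ + polylogSumNeg 1 z τ +
        2 * Real.pi * I * z / 2 - 2 * Real.pi * I * τ / 12)) {z | 0 < z.im ∧ z.im < τ.im} := by
  have hpi := two_pi_I_ne_zero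
  have ho := isOpen_strip τ
  have h0 : Set.EqOn (iteratedDeriv 0 fun w => ellTrilog w τ)
      (fun z => 1 / (2 * Real.pi * I) ^ 3 * (polylogSumPos 3 z τ + polylogSumNeg 3 z τ -
        (-(2 * Real.pi * I * z) ^ (2 + 1) / 12 +
          (2 * Real.pi * I * z) ^ (1 + 1) * (2 * Real.pi * I * τ) / 24 -
          (2 * Real.pi * I * τ) ^ 3 / 720) - ellPolylog 3 0 τ))
      {z | 0 < z.im ∧ z.im < τ.im} := by
    intro z _
    rw [iteratedDeriv_zero, ellTrilog, ellPolylog, chiPoly_three]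
    rfl
  have h1 : Set.EqOn (iteratedDeriv 1 fun w => ellTrilog w τ)
      (fun z => 1 / (2 * Real.pi * I) ^ 2 * (polylogSumPos 2 z τ - polylogSumNeg 2 z τ +
        (2 * Real.pi * I * z) ^ (1 + 1) / 4 -
          (2 * Real.pi * I * z) ^ (0 + 1) * (2 * Real.pi * I * τ) / 12))
      {z | 0 < z.im ∧ z.im < τ.im} := by
    refine iteratedDeriv_succ_eqOn ho h0 fun z hz => ?_
    have hp := hasDerivAt_polylogSumPos_left 2 hz.1 hτ
    have hn := hasDerivAt_polylogSumNeg_left 2 hz.2 hτ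
    have d3 := hasDerivAt_two_pi_I_mul_pow 2 z
    have d2 := hasDerivAt_two_pi_I_mul_pow 1 z
    refine ((((hp.add hn).sub (((d3.neg.div_const 12).add
      ((d2.mul_const (2 * Real.pi * I * τ)).div_const 24)).sub_const
        ((2 * Real.pi * I * τ) ^ 3 / 720))).sub_const (ellPolylog 3 0 τ)).const_mul
          (1 / (2 * Real.pi * I : ℂ) ^ 3)).congr_deriv ?_
    push_cast
    field_simp
    ring
  refine iteratedDeriv_succ_eqOn ho h1 fun z hz => ?_
  have hp := hasDerivAt_polylogSumPos_left 1 hz.1 hτ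
  have hn := hasDerivAt_polylogSumNeg_left 1 hz.2 hτ
  have d2 := hasDerivAt_two_pi_I_mul_pow 1 z
  have d1 := hasDerivAt_two_pi_I_mul_pow 0 z
  refine ((((hp.sub hn).add (d2.div_const 4)).sub
    ((d1.mul_const (2 * Real.pi * I * τ)).div_const 12)).const_mul
      (1 / (2 * Real.pi * I : ℂ) ^ 2)).congr_deriv ?_
  push_cast
  field_simp
  ring

theorem ellTrilogPartial_three_zero {z τ : ℂ} (hz : 0 < z.im) (hzτ : z.im < τ.im) :
    ellTrilogPartial 3 0 τ z = kroneckerOne τ z := by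
  have hτ := hz.trans hzτ
  have hpi := two_pi_I_ne_zero
  have h3 : Set.EqOn (iteratedDeriv 3 fun w => ellTrilog w τ)
      (fun z => polylogSumPos 0 z τ - polylogSumNeg 0 z τ + 1 / 2)
      {z | 0 < z.im ∧ z.im < τ.im} := by
    refine iteratedDeriv_succ_eqOn (isOpen_strip τ) (iteratedDeriv_two_ellTrilog hτ) fun z hz => ?_
    have hp := hasDerivAt_polylogSumPos_left 0 hz.1 hτ
    have hn := hasDerivAt_polylogSumNeg_left 0 hz.2 hτ
    have d1 := (hasDerivAt_id z).const_mul (2 * Real.pi * I : ℂ)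
    refine ((((hp.add hn).add (d1.div_const 2)).sub_const
      (2 * Real.pi * I * τ / 12)).const_mul (2 * Real.pi * I : ℂ)⁻¹).congr_deriv ?_
    field_simp
    ring
  rw [ellTrilogPartial, iteratedDeriv_zero, h3 ⟨hz, hzτ⟩, kroneckerOne_eq hτ]
  have e1 : polylogSumPos 0 z τ = ∑' n : ℕ, geomExp (n * τ + z) :=
    tsum_congr fun n => polylogSeries_zero_exp (by
      simp only [add_im, mul_im, natCast_re, natCast_im, zero_mul, add_zero]
      positivity)
  have e2 : polylogSumNeg 0 z τ = ∑' n : ℕ, geomExp ((n + 1 : ℕ) * τ - z) :=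
    tsum_congr fun n => polylogSeries_zero_exp (by
      simp only [sub_im, mul_im, natCast_re, natCast_im, zero_mul, add_zero]
      push_cast
      nlinarith [(Nat.cast_nonneg n : (0 : ℝ) ≤ n)])
  simp only [e1, e2]
  ring

theorem ellTrilogPartial_two_one {z τ : ℂ} (hz : 0 < z.im) (hzτ : z.im < τ.im) :
    ellTrilogPartial 2 1 τ z = kroneckerTwo τ z := by
  have hτ := hz.trans hzτ
  have hpi := two_pi_I_ne_zero
  have heq : (fun t => iteratedDeriv 2 (fun w => ellTrilog w t) z) =ᶠ[nhds τ]
      fun t => (2 * Real.pi * I)⁻¹ * (polylogSumPos 1 z t + polylogSumNeg 1 z t +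
        2 * Real.pi * I * z / 2 - 2 * Real.pi * I * t / 12) := by
    -- For fixed `z` the strip condition is open in `τ`, so the formula may be differentiated in
    -- `τ`.
    filter_upwards [(isOpen_lt continuous_const continuous_im).mem_nhds hzτ] with t ht
    exact iteratedDeriv_two_ellTrilog (hz.trans ht) ⟨hz, ht⟩
  have hp := hasDerivAt_polylogSumPos_right 0 hz hτ
  have hn := hasDerivAt_polylogSumNeg_right 0 hzτ hz
  have d1 := (hasDerivAt_id τ).const_mul (2 * Real.pi * I : ℂ)
  have hd := (((hp.add hn).add_const (2 * Real.pi * I * z / 2)).sub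
    (d1.div_const 12)).const_mul (2 * Real.pi * I : ℂ)⁻¹
  have e1 : ∀ n : ℕ, (n : ℂ) * polylogSeries 0 (exp (2 * Real.pi * I * (n * τ + z))) =
      n * geomExp (n * τ + z) := fun n => by
    rw [polylogSeries_zero_exp]
    simp only [add_im, mul_im, natCast_re, natCast_im, zero_mul, add_zero]
    positivity
  have e2 : ∀ n : ℕ, ((n + 1 : ℕ) : ℂ) *
      polylogSeries 0 (exp (2 * Real.pi * I * ((n + 1 : ℕ) * τ - z))) =
      (n + 1 : ℕ) * geomExp ((n + 1 : ℕ) * τ - z) := fun n => by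
    rw [polylogSeries_zero_exp]
    simp only [sub_im, mul_im, natCast_re, natCast_im, zero_mul, add_zero]
    push_cast
    nlinarith [(Nat.cast_nonneg n : (0 : ℝ) ≤ n)]
  rw [ellTrilogPartial, iteratedDeriv_one, heq.deriv_eq]
  refine hd.deriv.trans ?_
  rw [tsum_congr e1, tsum_congr e2, kroneckerTwo_eq hτ]
  have hlin : ∀ x y : ℂ, (2 * Real.pi * I : ℂ)⁻¹ * (2 * Real.pi * I * x + 2 * Real.pi * I * y -
      2 * Real.pi * I * 1 / 12) = x + y - 1 / 12 := fun x y => by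
    field_simp
  exact hlin _ _

theorem isTrilogDeriv_kroneckerOne {τ : ℂ} (hτ : 0 < τ.im) :
    IsTrilogDeriv 3 0 τ (kroneckerOne τ) :=
  ⟨differentiableOn_kroneckerOne hτ, fun _ h h' => (ellTrilogPartial_three_zero h h').symm⟩

theorem isTrilogDeriv_kroneckerTwo {τ : ℂ} (hτ : 0 < τ.im) :
    IsTrilogDeriv 2 1 τ (kroneckerTwo τ) :=
  ⟨differentiableOn_kroneckerTwo hτ, fun _ h h' => (ellTrilogPartial_two_one h h').symm⟩

theorem IsTrilogDeriv.isTrilogDeriv_trilogDeriv {n m : ℕ} {τ : ℂ} {G : ℂ → ℂ}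
    (h : IsTrilogDeriv n m τ G) : IsTrilogDeriv n m τ (trilogDeriv n m τ) := by
  have hex : ∃ G : ℂ → ℂ, IsTrilogDeriv n m τ G := ⟨G, h⟩
  rw [trilogDeriv, dif_pos hex]
  exact Classical.choose_spec hex

/-! ### The root system A₂ and the proposition -/

theorem a2Vectors_zero {V : Type*} [NormedAddCommGroup V] (α β : V) : a2Vectors α β 0 = α := rfl

theorem a2Vectors_one {V : Type*} [NormedAddCommGroup V] (α β : V) : a2Vectors α β 1 = β := rfl

theorem a2Vectors_two {V : Type*} [NormedAddCommGroup V] (α β : V) : a2Vectors α β 2 = -(α + β) := rfl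

section A2

variable {V : Type*} [NormedAddCommGroup V] [NormedSpace ℂ V] [FiniteDimensional ℂ V]

/-- `𝔽^{(a,b)}(ξ,η)` is a combination of the two rotations of the Weyl group. -/
theorem dunklF_a2_apply {B : LinearMap.BilinForm ℂ V} (hB : B.IsSymm) {α β : V}
    (hαα : B α α = 2) (hββ : B β β = 2) (hαβ : B α β = -1) {k : V → ℂ}
    (hk : ∀ i j, k (rootReflection B (a2Vectors α β i) (a2Vectors α β j)) = k (a2Vectors α β j))
    {τ : ℂ} (hτ : 0 < τ.im) {a b : ℤ}
    (ha : DifferentiableOn ℂ (dunklCoeff τ a) (periodLattice τ)ᶜ)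
    (hb : DifferentiableOn ℂ (dunklCoeff τ b) (periodLattice τ)ᶜ)
    {U : Set V} (hU : IsOpen U) (hUr : U ⊆ a2Regular B α β τ)
    (hUs : ∀ i, Set.MapsTo (rootReflection B (a2Vectors α β i)) U U)
    {φ : V → ℂ} (hφ : DifferentiableOn ℂ φ U) (ξ η : V) {z : V} (hz : z ∈ U) {x y : ℂ}
    (hx : B z α = x) (hy : B z β = y) :
    dunklF B α β k τ a b ξ η φ z =
      k α ^ 2 * (B α ξ * B β η - B α η * B β ξ) *
        ((dunklCoeff τ a x * dunklCoeff τ b (x + y) + dunklCoeff τ b x * dunklCoeff τ a (x + y) +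
          (dunklCoeff τ a y * dunklCoeff τ b (-x) + dunklCoeff τ b y * dunklCoeff τ a (-x)) +
          (dunklCoeff τ a (-(x + y)) * dunklCoeff τ b (-y) +
            dunklCoeff τ b (-(x + y)) * dunklCoeff τ a (-y))) *
              φ (rootReflection B β (rootReflection B α z)) -
        (dunklCoeff τ a y * dunklCoeff τ b (x + y) + dunklCoeff τ b y * dunklCoeff τ a (x + y) +
          (dunklCoeff τ a x * dunklCoeff τ b (-y) + dunklCoeff τ b x * dunklCoeff τ a (-y)) +
          (dunklCoeff τ a (-(x + y)) * dunklCoeff τ b (-x) +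
            dunklCoeff τ b (-(x + y)) * dunklCoeff τ a (-x))) *
              φ (rootReflection B α (rootReflection B β z))) := by
  have hβα : B β α = -1 := by rw [hB.eq, hαβ]
  have u : ∀ ζ, B (-(α + β)) ζ = -(B α ζ + B β ζ) := fun ζ => by
    rw [map_neg, map_add]; rfl
  have hγγ : B (-(α + β)) (-(α + β)) = 2 := by
    simp only [u]
    simp only [map_neg, map_add, hαα, hββ, hαβ, hβα]
    norm_num
  have hn : ∀ j, B (a2Vectors α β j) (a2Vectors α β j) = 2 := by
    intro j
    fin_cases j
    exacts [hαα, hββ, hγγ]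
  have hsα := rootReflection_eq hαα
  have hsβ := rootReflection_eq hββ
  have hsγ : ∀ z, rootReflection B (-(α + β)) z = z + (B α z + B β z) • -(α + β) := fun z => by
    rw [rootReflection_eq hγγ, u]
    module
  have hx' : B α z = x := by rw [hB.eq, hx]
  have hy' : B β z = y := by rw [hB.eq, hy]
  -- `s_α β = α + β = s_β α`; below, `s_γ γ = -γ = α + β` for `γ = -(α + β)`. Hence all three
  -- multiplicities agree.
  have hkαβ : k β = k α := by
    have h1 := hk 0 1
    have h2 := hk 1 0
    rw [a2Vectors_zero, a2Vectors_one, hsα, hαβ] at h1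
    rw [a2Vectors_zero, a2Vectors_one, hsβ, hβα] at h2
    rw [← h1, ← h2]
    congr 1
    module
  have hkγ : k (-(α + β)) = k α := by
    have h1 := hk 2 2
    have h2 := hk 1 0
    rw [a2Vectors_two, rootReflection_eq hγγ, hγγ] at h1
    rw [a2Vectors_zero, a2Vectors_one, hsβ, hβα] at h2
    rw [← h1, ← h2]
    congr 1
    module
  -- With `γ = -(α + β)`: `s_β s_α = s_γ s_β = s_α s_γ` is one rotation, and the reversed products
  -- are its inverse.
  have e1 : rootReflection B (-(α + β)) (rootReflection B β z) =
      rootReflection B β (rootReflection B α z) := by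
    simp only [hsα, hsβ, hsγ, map_sub, map_smul, smul_eq_mul,
      hββ, hαβ, hβα, hx', hy']
    module
  have e2 : rootReflection B α (rootReflection B (-(α + β)) z) =
      rootReflection B β (rootReflection B α z) := by
    simp only [hsα, hsβ, hsγ, map_neg, map_add, map_sub, map_smul, smul_eq_mul,
      hαα, hαβ, hβα, hx', hy']
    module
  have e3 : rootReflection B β (rootReflection B (-(α + β)) z) =
      rootReflection B α (rootReflection B β z) := by
    simp only [hsα, hsβ, hsγ, map_neg, map_add, map_sub, map_smul, smul_eq_mul,
      hββ, hαβ, hβα, hx', hy']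
    module
  have e4 : rootReflection B (-(α + β)) (rootReflection B α z) =
      rootReflection B α (rootReflection B β z) := by
    simp only [hsα, hsβ, hsγ, map_sub, map_smul, smul_eq_mul,
      hαα, hαβ, hβα, hx', hy']
    module
  have vγ : B z (-(α + β)) = -(x + y) := by rw [map_neg, map_add, hx, hy]
  have vα : ∀ v, B (rootReflection B α z) v = B z v - x * B α v := fun v => by
    rw [hsα, hx', map_sub, map_smul]; rfl
  have vβ : ∀ v, B (rootReflection B β z) v = B z v - y * B β v := fun v => by
    rw [hsβ, hy', map_sub, map_smul]; rfl
  have vγ' : ∀ v, B (rootReflection B (-(α + β)) z) v = B z v - (x + y) * (B α v + B β v) :=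
    fun v => by
      rw [hsγ, map_add, map_smul]
      change B z v + (B α z + B β z) * B (-(α + β)) v = _
      rw [u, hx', hy']
      ring
  have w1 : B (rootReflection B α z) β = x + y := by rw [vα, hy, hαβ]; ring
  have w2 : B (rootReflection B β z) (-(α + β)) = -x := by
    rw [vβ, vγ, map_neg, map_add, hβα, hββ]; ring
  have w3 : B (rootReflection B (-(α + β)) z) α = -y := by rw [vγ', hx, hαα, hβα]; ring
  have w4 : B (rootReflection B β z) α = x + y := by rw [vβ, hx, hβα]; ring
  have w5 : B (rootReflection B α z) (-(α + β)) = -y := by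
    rw [vα, vγ, map_neg, map_add, hαα, hαβ]; ring
  have w6 : B (rootReflection B (-(α + β)) z) β = -x := by rw [vγ', hy, hαβ, hββ]; ring
  -- The diagonal terms vanish. Since `α + β + γ = 0`, the antisymmetric factors of `(α,β)`, `(β,γ)`
  -- and `(γ,α)` coincide, so a common factor comes out, with opposite signs for the two rotations.
  rw [dunklF_apply hB hn k hτ ha hb hU hUr hUs hφ ξ η hz]
  simp only [Fin.sum_univ_three, a2Vectors_zero, a2Vectors_one, a2Vectors_two, hkαβ, hkγ, e1, e2,
    e3, e4, hx, hy, vγ, w1, w2, w3, w4, w5, w6, u]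
  ring

end A2

/-- The operators act on functions `φ` holomorphic on an open set `U` of regular points that is
stable under the three reflections (for instance on all regular points). -/
theorem mainTheorem7 {V : Type*} [NormedAddCommGroup V] [NormedSpace ℂ V] [FiniteDimensional ℂ V]
    (B : LinearMap.BilinForm ℂ V) (hB : B.IsSymm) (α β : V)
    (hαα : B α α = 2) (hββ : B β β = 2) (hαβ : B α β = -1)
    (k : V → ℂ)
    (hk : ∀ i j, k (rootReflection B (a2Vectors α β i) (a2Vectors α β j)) = k (a2Vectors α β j))
    (τ : ℂ) (hτ : 0 < τ.im) :
    (IsTrilogDeriv 3 0 τ (trilogDeriv 3 0 τ) ∧ IsTrilogDeriv 2 1 τ (trilogDeriv 2 1 τ)) ∧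
    ∀ U : Set V, IsOpen U → U ⊆ a2Regular B α β τ →
      (∀ i, Set.MapsTo (rootReflection B (a2Vectors α β i)) U U) →
      ∀ φ : V → ℂ, DifferentiableOn ℂ φ U → ∀ ξ η : V, ∀ z ∈ U,
        dunklF B α β k τ 0 (-1) ξ η φ z = 0 ∧
        dunklF B α β k τ 0 0 ξ η φ z + dunklF B α β k τ 1 (-1) ξ η φ z = 0 := by
  have h30 := (isTrilogDeriv_kroneckerOne hτ).isTrilogDeriv_trilogDeriv
  have h21 := (isTrilogDeriv_kroneckerTwo hτ).isTrilogDeriv_trilogDeriv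
  refine ⟨⟨h30, h21⟩, fun U hU hUr hUs φ hφ ξ η z hz => ?_⟩
  have c0 : dunklCoeff τ 0 = trilogDeriv 3 0 τ := rfl
  have c1 : dunklCoeff τ 1 = trilogDeriv 2 1 τ := rfl
  have cm : dunklCoeff τ (-1) = fun _ => 1 := rfl
  have d0 : DifferentiableOn ℂ (dunklCoeff τ 0) (periodLattice τ)ᶜ := c0 ▸ h30.1
  have d1 : DifferentiableOn ℂ (dunklCoeff τ 1) (periodLattice τ)ᶜ := c1 ▸ h21.1
  have dm : DifferentiableOn ℂ (dunklCoeff τ (-1)) (periodLattice τ)ᶜ :=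
    cm ▸ differentiableOn_const 1
  -- `trilogDeriv` is a chosen continuation; uniqueness identifies it with the explicit series off
  -- the lattice.
  have hg : ∀ {w : ℂ}, w ∉ periodLattice τ → dunklCoeff τ 0 w = kroneckerOne τ w := fun hw =>
    h30.eqOn hτ (isTrilogDeriv_kroneckerOne hτ) hw
  have hh : ∀ {w : ℂ}, w ∉ periodLattice τ → dunklCoeff τ 1 w = kroneckerTwo τ w := fun hw =>
    h21.eqOn hτ (isTrilogDeriv_kroneckerTwo hτ) hw
  have hx : B z α ∉ periodLattice τ := hUr hz 0
  have hy : B z β ∉ periodLattice τ := hUr hz 1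
  have hxy' : -(B z α + B z β) ∉ periodLattice τ := by
    have h := hUr hz 2
    rwa [a2Vectors_two, map_neg, map_add] at h
  have hxy : B z α + B z β ∉ periodLattice τ := by
    simpa using neg_notMem_periodLattice hxy'
  have hx' := neg_notMem_periodLattice hx
  have hy' := neg_notMem_periodLattice hy
  rw [dunklF_a2_apply hB hαα hββ hαβ hk hτ d0 dm hU hUr hUs hφ ξ η hz rfl rfl,
    dunklF_a2_apply hB hαα hββ hαβ hk hτ d0 d0 hU hUr hUs hφ ξ η hz rfl rfl,
    dunklF_a2_apply hB hαα hββ hαβ hk hτ d1 dm hU hUr hUs hφ ξ η hz rfl rfl]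
  simp only [cm, hg hx, hg hy, hg hxy, hg hx', hg hy', hg hxy', hh hx, hh hy, hh hxy, hh hx',
    hh hy', hh hxy', kroneckerOne_neg hτ hx, kroneckerOne_neg hτ hy, kroneckerOne_neg hτ hxy,
    kroneckerTwo_neg]
  have key := kroneckerOne_addition hτ hx hy hxy
  -- For index `-1` the coefficient is 1, and the six values of `g` cancel in opposite pairs. In the
  -- second identity each rotation has the coefficient `-2` times left minus right side of `key`, up
  -- to sign and the common factor.
  refine ⟨by ring, ?_⟩
  linear_combination (-2 * k α ^ 2 * (B α ξ * B β η - B α η * B β ξ) *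
    (φ (rootReflection B β (rootReflection B α z)) -
      φ (rootReflection B α (rootReflection B β z)))) * key
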